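/- Let $(R,\mathfrak m,k)$ be a commutative Noetherian local ring of Krull dimension $d$ that is Cohen-Macaulay and has minimal multiplicity, i.e. $e(R)=\mu(\mathfrak m)-d+1$, where $e(R)=\lim_{n\to\infty} d!\,\lambda_R(R/\mathfrak m^n)/n^d$ is the multiplicity of $R$ ($\lambda_R$ denotes length) and $\mu(\mathfrak m)$ is the minimal number of generators of $\mathfrak m$. Suppose that $R$ has a canonical module $\omega$, i.e. a finitely generated $R$-module with $\operatorname{rank}_k \operatorname{Ext}_R^i(k,\omega)=\delta_{id}$ for all $i\ge 0$. For $n\ge 0$ let $\Omega_n^R(k)$ be the $n$th syzygy module of $k$, i.e. the image of the $n$th differential of an augmented minimal free resolution of $k$ (so $\Omega_0^R(k)=k$). Let $L$ be a non-zero maximal Cohen-Macaulay $R$-module (finitely generated, with $\operatorname{depth} L=\dim L=d$) that is a homomorphic image of a finite direct sum of modules $\Omega_n^R(k)$, $n\ge 0$ (repetitions allowed). Then the following statements are equivalent: (i) $\operatorname{Ext}_R^i(\omega,L)=0$ for some $d+1$ consecutive values of $i\ge 1$; (ii) $\operatorname{Ext}_R^i(\omega,L)=0$ for all $i\ge 1$;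 (iii) $R$ is Gorenstein, i.e. $R$ has finite injective dimension as an $R$-module; (iv) $\operatorname{Tor}^R_i(\omega,L)=0$ for some $d+1$ consecutive values of $i\ge 1$; (v) $\operatorname{Tor}^R_i(\omega,L)=0$ for all $i\ge 1$. -/

import Mathlib

open CategoryTheory IsLocalRing

universe u

namespace CMLocal

section Depth

variable (R : Type u) [CommRing R] [IsLocalRing R]

/-- The depth of a module `M` over a local ring `R`: the supremum of the lengths of the
`M`-regular sequences contained in the maximal ideal. -/
noncomputable def depth (M : Type u) [AddCommGroup M] [Module R M] : ℕ∞ :=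
  ⨆ rs : {rs : List R // (∀ r ∈ rs, r ∈ maximalIdeal R) ∧ RingTheory.Sequence.IsRegular M rs},
    (rs.1.length : ℕ∞)

/-- A (non-zero) finitely generated module `M` is Cohen-Macaulay if `depth M = dim M`. -/
structure IsCohenMacaulayModule (M : Type u) [AddCommGroup M] [Module R M] : Prop where
  finite : Module.Finite R M
  depth_eq : (depth R M : WithBot ℕ∞) = Module.supportDim R M

/-- A (non-zero) module `M` is maximal Cohen-Macaulay if it is Cohen-Macaulay and
`dim M = dim R`. -/
structure IsMCM (M : Type u) [AddCommGroup M] [Module R M] : Prop where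
  isCohenMacaulayModule : IsCohenMacaulayModule R M
  dim_eq : Module.supportDim R M = ringKrullDim R

/-- A local ring is Cohen-Macaulay if it is so as a module over itself. -/
def IsCohenMacaulayRing : Prop := IsCohenMacaulayModule R R

end Depth

section Multiplicity

variable (R : Type u) [CommRing R] [IsLocalRing R]

/-- `e(R) = e`: the Hilbert-Samuel multiplicity
`lim_{n → ∞} d! · length (R / 𝔪 ^ n) / n ^ d`, where `d = dim R`, exists and is `e`.
(Over a Noetherian local ring the limit always exists and the lengths are finite.) -/
def HasMultiplicity (e : ℝ) : Prop :=
  ∃ d : ℕ, ringKrullDim R = d ∧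
    Filter.Tendsto
      (fun n : ℕ => (d.factorial : ℝ) *
        ((Module.length R (R ⧸ maximalIdeal R ^ n)).toNat : ℝ) / (n : ℝ) ^ d)
      Filter.atTop (nhds e)

/-- `R` has minimal multiplicity: `e(R) = μ(𝔪) - dim R + 1`, with `μ(𝔪)` the minimal number of
generators of the maximal ideal. -/
def HasMinimalMultiplicity : Prop :=
  ∃ d : ℕ, ringKrullDim R = d ∧
    HasMultiplicity R (((maximalIdeal R).spanFinrank : ℝ) - (d : ℝ) + 1)

end Multiplicity

section Syzygy

variable (R : Type u) [CommRing R] [IsLocalRing R]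

/-- An augmented minimal free resolution
`⋯ → F₂ → F₁ → F₀ → M → 0`, with `Fₙ = R ^ (rank n)`: the augmentation `ε` is surjective, the
sequence is exact, and each differential `d n : Fₙ₊₁ → Fₙ` has image in `𝔪 Fₙ`. -/
structure MinimalFreeResolution (M : Type u) [AddCommGroup M] [Module R M] where
  rank : ℕ → ℕ
  ε : (Fin (rank 0) → R) →ₗ[R] M
  d : ∀ n : ℕ, (Fin (rank (n + 1)) → R) →ₗ[R] (Fin (rank n) → R)
  ε_surjective : Function.Surjective ε
  exact_ε : Function.Exact (d 0) ε
  exact_d : ∀ n : ℕ, Function.Exact (d (n + 1)) (d n)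
  minimal : ∀ n : ℕ,
    LinearMap.range (d n) ≤ maximalIdeal R • (⊤ : Submodule R (Fin (rank n) → R))

variable {R}

/-- The `n`th syzygy module: the image of the `n`th differential of the augmented resolution,
the `0`th differential being the augmentation (so that the `0`th syzygy module is `M`). -/
noncomputable def MinimalFreeResolution.syzygy {M : Type u} [AddCommGroup M] [Module R M]
    (P : MinimalFreeResolution R M) : ℕ → ModuleCat.{u} R
  | 0 => ModuleCat.of R (LinearMap.range P.ε)
  | n + 1 => ModuleCat.of R (LinearMap.range (P.d n))

variable (R)

/-- `L` is a homomorphic image of a finite direct sum of syzygy modules of the residue field.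
(Minimal free resolutions exist and are unique up to isomorphism, so that the choice of `P` is
immaterial.) -/
def IsImageOfResidueFieldSyzygies (L : Type u) [AddCommGroup L] [Module R L] : Prop :=
  ∃ (P : MinimalFreeResolution R (ResidueField R)) (r : ℕ) (n : Fin r → ℕ)
    (f : ((j : Fin r) → P.syzygy (n j)) →ₗ[R] L), Function.Surjective f

end Syzygy

section Homological

variable (R : Type u) [CommRing R]

/-- The `R`-module `Ext_R^i(M, N)`. -/
noncomputable abbrev ExtModule (M N : Type u) [AddCommGroup M] [Module R M]
    [AddCommGroup N] [Module R N] (i : ℕ) : Type u :=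
  Abelian.Ext.{u} (ModuleCat.of R M) (ModuleCat.of R N) i

/-- The `R`-module `Tor_i^R(M, N)`. -/
noncomputable abbrev TorModule (M N : Type u) [AddCommGroup M] [Module R M]
    [AddCommGroup N] [Module R N] (i : ℕ) : ModuleCat.{u} R :=
  ((Tor (ModuleCat.{u} R) i).obj (ModuleCat.of R M)).obj (ModuleCat.of R N)

/-- A (Noetherian local) ring is Gorenstein if it has finite injective dimension as a module over
itself. -/
def IsGorenstein : Prop :=
  ∃ n : ℕ, HasInjectiveDimensionLE (ModuleCat.of R R) n

/-- A finitely generated module `ω` is a canonical module of `R` if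
`rank_k Ext_R^i(k, ω) = δ_{i d}` for all `i ≥ 0`, where `d = dim R`. Since `Ext_R^i(k, ω)` is
annihilated by the maximal ideal, its rank over `k` is its length over `R`. -/
structure IsCanonicalModule [IsLocalRing R] (ω : Type u) [AddCommGroup ω] [Module R ω] :
    Prop where
  finite : Module.Finite R ω
  length_ext : ∀ i : ℕ, Module.length R (ExtModule R (ResidueField R) ω i) =
    if (i : WithBot ℕ∞) = ringKrullDim R then 1 else 0

end Homological

end CMLocal

/-!
Vanishing of `d + 1` consecutive `Ext(ω, L)` or `Tor(ω, L)` forces a zero in the Betti numbers of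
`ω`. Indeed, after a flat local base change `R → S` with `𝔪_R S = 𝔪_S` and infinite residue field,
there is a superficial sequence `x₁, …, x_d` in `𝔪_S`, regular on `S` and on `S ⊗ L`, and minimal
multiplicity gives `𝔪_S² ⊆ (x₁, …, x_d)`. In the resolution `F` of `k`, every element of `𝔪F` whose
differential lies in `IF` is a boundary modulo `IF`; this holds for `I = 0` and survives adjoining a
superficial element to `I`. Hence `𝔪` kills the quotient of every syzygy of `k`, and then of
`S ⊗ L`, by `(x₁, …, x_d)`. Let `P` be the minimal free resolution of `ω`. Exactness of `Hom(P, L)`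
or `P ⊗ L` at `d + 1` consecutive places survives as exactness at one place modulo `(x₁, …, x_d)`.
There the maps vanish, their matrices having entries in `𝔪`, so the free module of `P` in that place
is zero.

A finite minimal free resolution of the maximal Cohen–Macaulay module `ω` has length `0`, by
`Ext(k, -)`; then `ω` is free and `R`, having the finite injective dimension of `ω`, is Gorenstein.
Conversely, if `R` is Gorenstein, then all syzygies of `ω` have injective dimension at most `d`,
which makes the short exact sequence of `Ω_{d+1}`, `Ω_d` split; by minimality the resolution is
again finite, so `ω` is free and all the `Ext` and `Tor` vanish.
-/

namespace CMLocal

/-! ### Ext groups and injective dimension -/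

section AbelianCategory

open Abelian

universe w v v'

variable {C : Type v'} [Category.{v} C] [Abelian C] [HasExt.{w} C]

theorem subsingleton_ext_of_retract_right {X Y Z : C} (h : Retract Y Z) {n : ℕ}
    (hZ : Subsingleton (Ext X Z n)) : Subsingleton (Ext X Y n) := by
  refine subsingleton_of_forall_eq 0 fun x ↦ ?_
  rw [← x.comp_mk₀_id, ← h.retract, ← Ext.mk₀_comp_mk₀, ← Ext.comp_assoc_of_second_deg_zero,
    Subsingleton.elim (x.comp _ (add_zero n)) 0, Ext.zero_comp]

theorem subsingleton_ext_congr_right {X Y Z : C} (e : Y ≅ Z) {n : ℕ} :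
    Subsingleton (Ext X Y n) ↔ Subsingleton (Ext X Z n) :=
  ⟨subsingleton_ext_of_retract_right (.ofIso e.symm),
    subsingleton_ext_of_retract_right (.ofIso e)⟩

theorem subsingleton_ext_congr_left {X Y Z : C} (e : X ≅ Y) {n : ℕ} :
    Subsingleton (Ext X Z n) ↔ Subsingleton (Ext Y Z n) :=
  (((extFunctor n).mapIso e.symm.op).app Z).addCommGroupIsoToAddEquiv.toEquiv.subsingleton_congr

theorem subsingleton_ext_of_isZero_left {X Y : C} (hX : Limits.IsZero X) (n : ℕ) :
    Subsingleton (Ext X Y n) :=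
  subsingleton_of_forall_eq 0 fun x ↦ by
    rw [← x.mk₀_id_comp, hX.eq_of_src (𝟙 X) 0, Ext.mk₀_zero, Ext.zero_comp]

variable {S : ShortComplex C} (hS : S.ShortExact)

include hS

theorem ext_eq_zero_of_comp_mk₀_eq_zero {X : C} {n : ℕ}
    (h₃ : ∀ i, i + 1 = n → Subsingleton (Ext X S.X₃ i)) {x : Ext X S.X₁ n}
    (hx : x.comp (Ext.mk₀ S.f) (add_zero n) = 0) : x = 0 := by
  cases n with
  | zero =>
    have := hS.mono_f
    exact (injective_iff_map_eq_zero _).mp (Ext.postcomp_mk₀_injective_of_mono X S.f) x hx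
  | succ n =>
    have := h₃ n rfl
    obtain ⟨y, rfl⟩ := Ext.covariant_sequence_exact₁ X hS x hx rfl
    rw [Subsingleton.elim y 0, Ext.zero_comp]

theorem subsingleton_ext_of_covariant₁ {X : C} {n : ℕ}
    (h₃ : ∀ i, i + 1 = n → Subsingleton (Ext X S.X₃ i)) (h₂ : Subsingleton (Ext X S.X₂ n)) :
    Subsingleton (Ext X S.X₁ n) :=
  subsingleton_of_forall_eq 0 fun _ ↦
    ext_eq_zero_of_comp_mk₀_eq_zero hS h₃ (h₂.elim _ _)

theorem subsingleton_ext_of_covariant₃ {X : C} {n : ℕ} (h₂ : Subsingleton (Ext X S.X₂ n))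
    (h₁ : Subsingleton (Ext X S.X₁ (n + 1))) : Subsingleton (Ext X S.X₃ n) := by
  refine subsingleton_of_forall_eq 0 fun x ↦ ?_
  obtain ⟨y, rfl⟩ := Ext.covariant_sequence_exact₃ X hS x rfl (Subsingleton.elim _ _)
  rw [Subsingleton.elim y 0, Ext.zero_comp]

theorem subsingleton_ext_of_contravariant₁ {Y : C} {n : ℕ} (h₂ : Subsingleton (Ext S.X₂ Y n))
    (h₃ : Subsingleton (Ext S.X₃ Y (n + 1))) : Subsingleton (Ext S.X₁ Y n) := by
  refine subsingleton_of_forall_eq 0 fun x ↦ ?_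
  obtain ⟨y, rfl⟩ := Ext.contravariant_sequence_exact₁ hS Y x (add_comm 1 n)
    (Subsingleton.elim _ _)
  rw [Subsingleton.elim y 0, Ext.comp_zero]

theorem subsingleton_ext_of_contravariant₂ {Y : C} {n : ℕ} (h₁ : Subsingleton (Ext S.X₁ Y n))
    (h₃ : Subsingleton (Ext S.X₃ Y n)) : Subsingleton (Ext S.X₂ Y n) := by
  refine subsingleton_of_forall_eq 0 fun x ↦ ?_
  obtain ⟨y, rfl⟩ := Ext.contravariant_sequence_exact₂ hS Y x (Subsingleton.elim _ _)
  rw [Subsingleton.elim y 0, Ext.comp_zero]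

theorem exists_comp_eq_of_subsingleton_ext_one {Y : C} (h : Subsingleton (Ext S.X₃ Y 1))
    (φ : S.X₁ ⟶ Y) : ∃ ψ : S.X₂ ⟶ Y, S.f ≫ ψ = φ := by
  obtain ⟨y, hy⟩ := Ext.contravariant_sequence_exact₁ hS Y (Ext.mk₀ φ) (add_zero 1)
    (Subsingleton.elim _ _)
  obtain ⟨ψ, rfl⟩ := Ext.homEquiv₀.symm.surjective y
  exact ⟨ψ, Ext.homEquiv₀.symm.injective (by simpa using hy)⟩

end AbelianCategory

section ExtModule

variable {R : Type u} [CommRing R] {A B C X : Type u} [AddCommGroup A] [AddCommGroup B]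
  [AddCommGroup C] [AddCommGroup X] [Module R A] [Module R B] [Module R C] [Module R X]

theorem shortExact_of_exact {f : A →ₗ[R] B} {g : B →ₗ[R] C} (hf : Function.Injective f)
    (hfg : Function.Exact f g) (hg : Function.Surjective g) :
    (ModuleCat.shortComplexOfCompEqZero f g hfg.linearMap_comp_eq_zero).ShortExact :=
  ModuleCat.shortComplex_shortExact _ hfg hf hg

theorem subsingleton_ext_zero_iff : Subsingleton (ExtModule R A B 0) ↔ Subsingleton (A →ₗ[R] B) :=
  (Abelian.Ext.addEquiv₀.trans ModuleCat.homAddEquiv).toEquiv.subsingleton_congr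

theorem subsingleton_ext_of_projective [Module.Projective R A] (n : ℕ) :
    Subsingleton (ExtModule R A B (n + 1)) :=
  have : Projective (ModuleCat.of R A) := (IsProjective.iff_projective A).mp inferInstance
  Abelian.Ext.subsingleton_of_projective _ _ _

theorem subsingleton_ext_pi_iff {ι : Type} [Finite ι] {n : ℕ} :
    Subsingleton (ExtModule R X (ι → A) n) ↔ Subsingleton (ι → ExtModule R X A n) := by
  have := Fintype.ofFinite ι
  rw [← subsingleton_ext_congr_right (ModuleCat.biproductIsoPi fun _ : ι ↦ ModuleCat.of R A)]
  exact (Abelian.Ext.addEquivBiproduct (ModuleCat.of R X)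
    (Limits.biproduct.isBilimit fun _ : ι ↦ ModuleCat.of R A) n).toEquiv.subsingleton_congr

theorem subsingleton_ext_pi {ι : Type} [Finite ι] {n : ℕ}
    (h : Subsingleton (ExtModule R X A n)) : Subsingleton (ExtModule R X (ι → A) n) :=
  subsingleton_ext_pi_iff.mpr (@Pi.instSubsingleton _ _ fun _ ↦ h)

theorem subsingleton_ext_of_pi {ι : Type} [Finite ι] [Nonempty ι] {n : ℕ}
    (h : Subsingleton (ExtModule R X (ι → A) n)) : Subsingleton (ExtModule R X A n) :=
  have := subsingleton_ext_pi_iff.mp h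
  (Function.const_injective (α := ι)).subsingleton

theorem ext_comp_mk₀_eq_zero_of_mem_smul_top {φ : A →ₗ[R] B}
    (hφ : φ ∈ Module.annihilator R X • (⊤ : Submodule R (A →ₗ[R] B))) {n : ℕ}
    (x : ExtModule R X A n) :
    Abelian.Ext.comp x (Abelian.Ext.mk₀ (ModuleCat.ofHom φ)) (add_zero n) = 0 := by
  induction hφ using Submodule.smul_induction_on' with
  | smul r hr ψ _ =>
    have hX : r • 𝟙 (ModuleCat.of R X) = 0 := by ext a; exact Module.mem_annihilator.mp hr a
    rw [show ModuleCat.ofHom (r • ψ) = r • ModuleCat.ofHom ψ from rfl,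
      Abelian.Ext.mk₀_smul, Abelian.Ext.comp_smul, ← Abelian.Ext.smul_comp, ← x.mk₀_id_comp,
      ← Abelian.Ext.smul_comp, ← Abelian.Ext.mk₀_smul, hX, Abelian.Ext.mk₀_zero,
      Abelian.Ext.zero_comp, Abelian.Ext.zero_comp]
  | add φ _ ψ _ hφ hψ =>
    rw [ModuleCat.ofHom_add, Abelian.Ext.mk₀_add, Abelian.Ext.comp_add, hφ, hψ, add_zero]

end ExtModule

section MulQuotient

variable {R : Type*} [CommRing R] {I J : Ideal R} {x : R}

/-- Multiplication by `x` as a map `R ⧸ I → R ⧸ J`, defined when `x I ⊆ J`. -/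
def mulQuotient (x : R) (h : ∀ c ∈ I, x * c ∈ J) : (R ⧸ I) →ₗ[R] R ⧸ J :=
  Submodule.mapQ I J (LinearMap.mulLeft R x) h

theorem mulQuotient_mk (h : ∀ c ∈ I, x * c ∈ J) (c : R) :
    mulQuotient x h (Ideal.Quotient.mk I c) = Ideal.Quotient.mk J (x * c) := rfl

theorem mulQuotient_injective (h : ∀ c, x * c ∈ J ↔ c ∈ I) :
    Function.Injective (mulQuotient x fun c ↦ (h c).mpr) := by
  refine (injective_iff_map_eq_zero _).mpr fun a ha ↦ ?_
  obtain ⟨c, rfl⟩ := Ideal.Quotient.mk_surjective a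
  rw [mulQuotient_mk, Ideal.Quotient.eq_zero_iff_mem] at ha
  exact Ideal.Quotient.eq_zero_iff_mem.mpr ((h c).mp ha)

theorem exact_mulQuotient (h : ∀ c ∈ I, x * c ∈ J) :
    Function.Exact (mulQuotient x h)
      (Submodule.factor (le_sup_left : J ≤ J ⊔ Ideal.span {x})) := by
  intro a
  obtain ⟨b, rfl⟩ := Ideal.Quotient.mk_surjective a
  rw [show Submodule.factor le_sup_left (Ideal.Quotient.mk J b) =
    Ideal.Quotient.mk (J ⊔ Ideal.span {x}) b from rfl, Ideal.Quotient.eq_zero_iff_mem]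
  constructor
  · intro hb
    obtain ⟨j, hj, _, hy, rfl⟩ := Submodule.mem_sup.mp hb
    obtain ⟨c, rfl⟩ := Ideal.mem_span_singleton.mp hy
    exact ⟨Ideal.Quotient.mk I c, Ideal.Quotient.eq.mpr (by simpa using hj)⟩
  · rintro ⟨a, ha⟩
    obtain ⟨c, rfl⟩ := Ideal.Quotient.mk_surjective a
    have hsub := Ideal.mem_sup_left (T := Ideal.span {x}) (Ideal.Quotient.eq.mp ha)
    have hxc : x * c ∈ J ⊔ Ideal.span {x} :=
      Ideal.mem_sup_right (Ideal.mul_mem_right _ _ (Ideal.mem_span_singleton_self x))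
    simpa using Ideal.sub_mem _ hxc hsub

theorem shortExact_mulQuotient {R : Type u} [CommRing R] {I J : Ideal R} {x : R}
    (h : ∀ c, x * c ∈ J ↔ c ∈ I) :
    (ModuleCat.shortComplexOfCompEqZero _ _
      (exact_mulQuotient fun c ↦ (h c).mpr).linearMap_comp_eq_zero).ShortExact :=
  shortExact_of_exact (mulQuotient_injective h) (exact_mulQuotient _)
    (Submodule.factor_surjective _)

end MulQuotient

section InjectiveDimension

variable {R : Type u} [CommRing R] {K : Type u} [AddCommGroup K] [Module R K]

theorem hasInjectiveDimensionLT_of_subsingleton_ext_quotient (n : ℕ) (K : Type u) [AddCommGroup K]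
    [Module R K] (h : ∀ I : Ideal R, Subsingleton (ExtModule R (R ⧸ I) K (n + 1))) :
    HasInjectiveDimensionLT (ModuleCat.of R K) (n + 1) := by
  induction n generalizing K with
  | zero =>
    rw [zero_add, ← injective_iff_hasInjectiveDimensionLT_one,
      ← Module.injective_iff_injective_object, ← Module.Baer.iff_injective]
    intro I φ
    obtain ⟨ψ, hψ⟩ := exists_comp_eq_of_subsingleton_ext_one
      (shortExact_of_exact I.injective_subtype (LinearMap.exact_subtype_mkQ I)
        (Submodule.mkQ_surjective I)) (h I) (ModuleCat.ofHom φ)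
    exact ⟨ψ.hom, fun x hx ↦ congr($(hψ).hom ⟨x, hx⟩)⟩
  | succ n ih =>
    obtain ⟨E, hE, f, hf⟩ := EnoughInjectives.presentation (ModuleCat.of R K)
    have hS := shortExact_of_exact ((ModuleCat.mono_iff_injective f).mp hf)
      f.hom.exact_map_mkQ_range (Submodule.mkQ_surjective _)
    refine (hS.hasInjectiveDimensionLT_X₃_iff n hE).mp (ih _ fun I ↦ ?_)
    exact subsingleton_ext_of_covariant₃ hS
      (HasInjectiveDimensionLT.subsingleton E 1 _ (by lia) _) (h I)

theorem subsingleton_ext_quotient_of_colon {I : Ideal R} {a : R} {i : ℕ}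
    (hcolon : Subsingleton (ExtModule R (R ⧸ I.colon {a}) K i))
    (hsup : Subsingleton (ExtModule R (R ⧸ (I ⊔ Ideal.span {a})) K i)) :
    Subsingleton (ExtModule R (R ⧸ I) K i) :=
  subsingleton_ext_of_contravariant₂
    (shortExact_mulQuotient (I := I.colon {a}) (x := a) fun c ↦ by
      rw [Submodule.mem_colon_singleton, smul_eq_mul, mul_comm]) hcolon hsup

variable [IsLocalRing R]

theorem subsingleton_of_top_le_maximalIdeal_smul {M : Type*} [AddCommGroup M] [Module R M]
    [Module.Finite R M] (h : (⊤ : Submodule R M) ≤ maximalIdeal R • ⊤) : Subsingleton M := by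
  have := Submodule.eq_bot_of_le_smul_of_le_jacobson_bot (maximalIdeal R) _ Module.Finite.fg_top h
    (IsLocalRing.maximalIdeal_le_jacobson _)
  exact (Submodule.subsingleton_iff R).mp (subsingleton_of_bot_eq_top this.symm)

variable [IsNoetherianRing R] [Module.Finite R K]

theorem subsingleton_ext_quotient_of_isPrime {p : Ideal R} (hp : p.IsPrime) {z : R}
    (hz : z ∈ maximalIdeal R) (hzp : z ∉ p) {i : ℕ}
    (h : Subsingleton (ExtModule R (R ⧸ (p ⊔ Ideal.span {z})) K (i + 1))) :
    Subsingleton (ExtModule R (R ⧸ p) K i) := by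
  have hzc (c : R) : z * c ∈ p ↔ c ∈ p := by simp only [hp.mul_mem_iff_mem_or_mem, hzp, false_or]
  have : Module.Finite R (ExtModule R (R ⧸ p) K i) :=
    ModuleCat.finite_ext R (.of R (R ⧸ p)) (.of R K) i
  refine subsingleton_of_top_le_maximalIdeal_smul (R := R) fun x _ ↦ ?_
  obtain ⟨y, rfl⟩ := Abelian.Ext.contravariant_sequence_exact₁ (shortExact_mulQuotient hzc)
    (ModuleCat.of R K) x (add_comm 1 i) (@Subsingleton.elim _ h _ _)
  have hmul : ModuleCat.ofHom (mulQuotient z fun c ↦ (hzc c).mpr) =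
    z • 𝟙 (ModuleCat.of R (R ⧸ p)) := rfl
  have hy : (Abelian.Ext.mk₀ (ModuleCat.ofHom (mulQuotient z fun c ↦ (hzc c).mpr))).comp y
      (zero_add i) = z • y := by
    rw [hmul, Abelian.Ext.mk₀_smul, Abelian.Ext.smul_comp, Abelian.Ext.mk₀_id_comp]
  exact hy ▸ Submodule.smul_mem_smul hz trivial

theorem subsingleton_ext_quotient_of_residueField {t : ℕ}
    (h : ∀ i, t ≤ i → Subsingleton (ExtModule R (ResidueField R) K i)) (I : Ideal R) :
    ∀ i, t ≤ i → Subsingleton (ExtModule R (R ⧸ I) K i) := by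
  induction I using WellFoundedGT.induction with | _ I ih
  intro i hi
  by_cases htop : I = ⊤
  · subst htop
    exact subsingleton_ext_of_isZero_left (ModuleCat.isZero_of_subsingleton _) i
  obtain rfl | hne := eq_or_ne I (maximalIdeal R)
  · exact h i hi
  by_cases hp : I.IsPrime
  · obtain ⟨z, hz, hzI⟩ := SetLike.exists_of_lt ((le_maximalIdeal htop).lt_of_ne hne)
    exact subsingleton_ext_quotient_of_isPrime hp hz hzI
      (ih _ (Submodule.lt_sup_iff_notMem.mpr hzI) (i + 1) (by lia))
  · obtain ⟨a, b, hab, ha, hb⟩ : ∃ a b, a * b ∈ I ∧ a ∉ I ∧ b ∉ I := by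
      simpa [Ideal.isPrime_iff, htop] using hp
    have hlt : I < I.colon {b} :=
      SetLike.lt_iff_le_and_exists.mpr ⟨Ideal.le_colon, a, by
        rwa [Submodule.mem_colon_singleton], ha⟩
    exact subsingleton_ext_quotient_of_colon (ih _ hlt i hi)
      (ih _ (Submodule.lt_sup_iff_notMem.mpr hb) i hi)

theorem hasInjectiveDimensionLT_of_subsingleton_ext_residueField {t : ℕ}
    (h : ∀ i, t + 1 ≤ i → Subsingleton (ExtModule R (ResidueField R) K i)) :
    HasInjectiveDimensionLT (ModuleCat.of R K) (t + 1) :=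
  hasInjectiveDimensionLT_of_subsingleton_ext_quotient t K fun I ↦
    subsingleton_ext_quotient_of_residueField h I _ le_rfl

end InjectiveDimension

/-! ### Depth, minimal free resolutions and canonical modules -/

section Depth

variable {R : Type u} [CommRing R] [IsLocalRing R] {M : Type u} [AddCommGroup M] [Module R M]

theorem support_residueField :
    Module.support R (ResidueField R) = PrimeSpectrum.zeroLocus (maximalIdeal R) := by
  change Module.support R (R ⧸ maximalIdeal R) = _
  rw [Module.support_eq_zeroLocus, Ideal.annihilator_quotient]

theorem length_le_depth {rs : List R} (hrs : ∀ r ∈ rs, r ∈ maximalIdeal R)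
    (hreg : RingTheory.Sequence.IsRegular M rs) : (rs.length : ℕ∞) ≤ depth R M :=
  le_iSup (fun rs : {rs : List R // (∀ r ∈ rs, r ∈ maximalIdeal R) ∧
    RingTheory.Sequence.IsRegular M rs} ↦ (rs.1.length : ℕ∞)) ⟨rs, hrs, hreg⟩

variable [Module.Finite R M]

theorem maximalIdeal_smul_top_lt [Nontrivial M] : maximalIdeal R • (⊤ : Submodule R M) < ⊤ :=
  lt_top_iff_ne_top.mpr fun h ↦
    not_subsingleton M (subsingleton_of_top_le_maximalIdeal_smul h.ge)

variable [IsNoetherianRing R]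

theorem exists_isRegular_of_subsingleton_ext [Nontrivial M] {n : ℕ}
    (h : ∀ i < n, Subsingleton (ExtModule R (ResidueField R) M i)) :
    ∃ rs : List R, rs.length = n ∧ (∀ r ∈ rs, r ∈ maximalIdeal R) ∧
      RingTheory.Sequence.IsRegular M rs :=
  have : Module.Finite R (ResidueField R) := inferInstanceAs (Module.Finite R (R ⧸ maximalIdeal R))
  ModuleCat.exists_isRegular_of_exists_subsingleton_ext (maximalIdeal R) n (.of R M)
    maximalIdeal_smul_top_lt (.of R (ResidueField R)) support_residueField h

theorem subsingleton_ext_of_lt_depth {i : ℕ} (hi : i < depth R M) :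
    Subsingleton (ExtModule R (ResidueField R) M i) := by
  obtain ⟨⟨rs, hrs, hreg⟩, hlt⟩ := lt_iSup_iff.mp hi
  have : Nontrivial M := hreg.nontrivial
  have : Module.Finite R (ResidueField R) := inferInstanceAs (Module.Finite R (R ⧸ maximalIdeal R))
  exact ModuleCat.subsingleton_ext_of_exists_isRegular (maximalIdeal R) (.of R (ResidueField R))
    support_residueField.subset (.of R M) maximalIdeal_smul_top_lt rs hrs hreg i
    (by exact_mod_cast hlt)

variable [Nontrivial M] {d : ℕ}

theorem exists_isRegular_of_depth_eq (h : depth R M = d) :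
    ∃ rs : List R, rs.length = d ∧ (∀ r ∈ rs, r ∈ maximalIdeal R) ∧
      RingTheory.Sequence.IsRegular M rs :=
  exists_isRegular_of_subsingleton_ext fun i hi ↦
    subsingleton_ext_of_lt_depth (h ▸ by exact_mod_cast hi)

theorem not_subsingleton_ext_of_depth_eq (h : depth R M = d) :
    ¬ Subsingleton (ExtModule R (ResidueField R) M d) := by
  intro hd
  obtain ⟨rs, hlen, hrs, hreg⟩ :=
    exists_isRegular_of_subsingleton_ext (R := R) (M := M) (n := d + 1) fun i hi ↦ by
      obtain hi | rfl := Nat.lt_succ_iff_lt_or_eq.mp hi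
      · exact subsingleton_ext_of_lt_depth (h ▸ by exact_mod_cast hi)
      · exact hd
  have hle := length_le_depth hrs hreg
  rw [hlen, h] at hle
  exact absurd (by exact_mod_cast hle) (Nat.lt_succ_self d).not_ge

end Depth

section MinimalCover

variable {R : Type u} [CommRing R]

theorem mem_smul_top_pi_iff {ι : Type*} [Finite ι] {I : Ideal R} {v : ι → R} :
    v ∈ I • (⊤ : Submodule R (ι → R)) ↔ ∀ i, v i ∈ I := by
  classical
  have := Fintype.ofFinite ι
  refine ⟨fun h i ↦ ?_, fun h ↦ ?_⟩
  · have hle : I • (⊤ : Submodule R (ι → R)) ≤ Submodule.comap (LinearMap.proj i) I :=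
      Submodule.smul_le.mpr fun r hr n _ ↦ I.mul_mem_right _ hr
    exact hle h
  · rw [pi_eq_sum_univ v]
    exact Submodule.sum_mem _ fun i _ ↦ Submodule.smul_mem_smul (h i) trivial

theorem mem_smul_top_of_range_le {ι : Type*} [Finite ι] {B : Type*} [AddCommGroup B] [Module R B]
    {I : Ideal R} {f : (ι → R) →ₗ[R] B} (hf : LinearMap.range f ≤ I • ⊤) :
    f ∈ I • (⊤ : Submodule R ((ι → R) →ₗ[R] B)) := by
  classical
  have := Fintype.ofFinite ι
  have hsum : f = ∑ i, (LinearMap.proj i : (ι → R) →ₗ[R] R).smulRight (f (Pi.single i 1)) := by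
    ext i
    simp [Pi.single_apply]
  rw [hsum]
  refine Submodule.sum_mem _ fun i _ ↦ ?_
  have hmem := Submodule.mem_map_of_mem
    (f := LinearMap.smulRightₗ (LinearMap.proj i : (ι → R) →ₗ[R] R))
    (hf (LinearMap.mem_range_self f (Pi.single i 1)))
  rw [Submodule.map_smul''] at hmem
  exact Submodule.smul_mono le_rfl le_top hmem

variable [IsLocalRing R]

open TensorProduct in
theorem exists_minimal_cover (M : Type u) [AddCommGroup M] [Module R M] [Module.Finite R M] :
    ∃ (n : ℕ) (f : (Fin n → R) →ₗ[R] M), Function.Surjective f ∧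
      LinearMap.ker f ≤ maximalIdeal R • ⊤ := by
  let b := Module.finBasis (ResidueField R) (ResidueField R ⊗[R] M)
  choose m hm using fun i ↦
    TensorProduct.mk_surjective R M (ResidueField R) Ideal.Quotient.mk_surjective (b i)
  refine ⟨_, Fintype.linearCombination R m, ?_, fun v hv ↦ mem_smul_top_pi_iff.mpr fun i ↦ ?_⟩
  · rw [← LinearMap.range_eq_top, Fintype.range_linearCombination]
    exact IsLocalRing.span_eq_top_of_tmul_eq_basis m b hm
  · have hsum : ∑ i, residue R (v i) • b i = 0 := by
      simp_rw [← hm, TensorProduct.mk_apply, ← ResidueField.algebraMap_eq, algebraMap_smul,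
        ← TensorProduct.tmul_smul, ← TensorProduct.tmul_sum]
      rw [← Fintype.linearCombination_apply, LinearMap.mem_ker.mp hv, TensorProduct.tmul_zero]
    exact (residue_eq_zero_iff _).mp
      (Fintype.linearIndependent_iff.mp b.linearIndependent _ hsum i)

variable [IsNoetherianRing R]

theorem exists_minimal_cover_kernel (s : Σ n : ℕ, Submodule R (Fin n → R)) :
    ∃ (t : Σ n : ℕ, Submodule R (Fin n → R)) (f : (Fin t.1 → R) →ₗ[R] (Fin s.1 → R)),
      LinearMap.range f = s.2 ∧ LinearMap.ker f = t.2 ∧ t.2 ≤ maximalIdeal R • ⊤ := by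
  obtain ⟨n, f, hf, hmin⟩ := exists_minimal_cover (R := R) s.2
  refine ⟨⟨n, LinearMap.ker f⟩, s.2.subtype ∘ₗ f, ?_, ?_, hmin⟩
  · rw [LinearMap.range_comp, LinearMap.range_eq_top.mpr hf, Submodule.map_top,
      Submodule.range_subtype]
  · exact LinearMap.ker_comp_of_ker_eq_bot _ s.2.ker_subtype

theorem nonempty_minimalFreeResolution (M : Type u) [AddCommGroup M] [Module R M]
    [Module.Finite R M] : Nonempty (MinimalFreeResolution R M) := by
  obtain ⟨n, f, hf, hmin⟩ := exists_minimal_cover (R := R) M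
  choose t φ hrange hker hle using exists_minimal_cover_kernel (R := R)
  let s : ℕ → Σ n : ℕ, Submodule R (Fin n → R) := Nat.rec ⟨n, LinearMap.ker f⟩ fun _ s ↦ t s
  refine ⟨{
    rank := fun i ↦ (s i).1
    ε := f
    d := fun i ↦ φ (s i)
    ε_surjective := hf
    exact_ε := LinearMap.exact_iff.mpr (hrange (s 0)).symm
    exact_d := fun i ↦ LinearMap.exact_iff.mpr ((hker (s i)).trans (hrange (s (i + 1))).symm)
    minimal := fun i ↦ (hrange (s i)).trans_le ?_ }⟩
  cases i with
  | zero => exact hmin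
  | succ i => exact hle (s i)

end MinimalCover

namespace MinimalFreeResolution

section Syzygy

variable {R : Type u} [CommRing R] [IsLocalRing R] {M : Type u} [AddCommGroup M] [Module R M]
  (P : MinimalFreeResolution R M)

/-- The canonical surjection from a term of a free resolution to the corresponding syzygy. -/
noncomputable def cover : ∀ n : ℕ, (Fin (P.rank n) → R) →ₗ[R] P.syzygy n
  | 0 => P.ε.rangeRestrict
  | n + 1 => (P.d n).rangeRestrict

/-- The inclusion of a syzygy in the preceding term of the resolution. -/
noncomputable def inclusion (n : ℕ) : P.syzygy (n + 1) →ₗ[R] (Fin (P.rank n) → R) :=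
  (LinearMap.range (P.d n)).subtype

/-- The zeroth syzygy is the module itself. -/
noncomputable def syzygyZeroEquiv : P.syzygy 0 ≃ₗ[R] M :=
  LinearEquiv.ofTop _ (LinearMap.range_eq_top.mpr P.ε_surjective)

theorem inclusion_injective (n : ℕ) : Function.Injective (P.inclusion n) :=
  Submodule.injective_subtype _

theorem range_inclusion (n : ℕ) : LinearMap.range (P.inclusion n) = LinearMap.range (P.d n) :=
  Submodule.range_subtype _

theorem cover_surjective : ∀ n : ℕ, Function.Surjective (P.cover n)
  | 0 => P.ε.surjective_rangeRestrict
  | n + 1 => (P.d n).surjective_rangeRestrict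

theorem exact_d_cover : ∀ n : ℕ, Function.Exact (P.d n) (P.cover n)
  | 0 => LinearMap.exact_iff.mpr (P.ε.ker_rangeRestrict.trans (LinearMap.exact_iff.mp P.exact_ε))
  | n + 1 => LinearMap.exact_iff.mpr
      ((P.d n).ker_rangeRestrict.trans (LinearMap.exact_iff.mp (P.exact_d n)))

theorem exact_inclusion_cover (n : ℕ) : Function.Exact (P.inclusion n) (P.cover n) :=
  LinearMap.exact_iff.mpr
    ((LinearMap.exact_iff.mp (P.exact_d_cover n)).trans (P.range_inclusion n).symm)

theorem inclusion_comp_cover (n : ℕ) : P.inclusion n ∘ₗ P.cover (n + 1) = P.d n := rfl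

theorem finite_syzygy (n : ℕ) : Module.Finite R (P.syzygy n) :=
  Module.Finite.of_surjective _ (P.cover_surjective n)

theorem shortExact_syzygy (n : ℕ) :
    (ModuleCat.shortComplexOfCompEqZero (P.inclusion n) (P.cover n)
      (P.exact_inclusion_cover n).linearMap_comp_eq_zero).ShortExact :=
  shortExact_of_exact (P.inclusion_injective n) (P.exact_inclusion_cover n) (P.cover_surjective n)

theorem rank_eq_zero_of_subsingleton_syzygy {n : ℕ} [Subsingleton (P.syzygy n)] :
    P.rank n = 0 := by
  by_contra hn
  have hmem : (fun _ ↦ 1 : Fin (P.rank n) → R) ∈ LinearMap.range (P.d n) :=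
    (P.exact_d_cover n _).mp (Subsingleton.elim _ _)
  exact (Ideal.ne_top_iff_one _).mp (maximalIdeal.isMaximal R).ne_top
    (mem_smul_top_pi_iff.mp (P.minimal n hmem) ⟨0, Nat.pos_of_ne_zero hn⟩)

theorem cover_injective {n : ℕ} (h : P.rank (n + 1) = 0) : Function.Injective (P.cover n) := by
  have : IsEmpty (Fin (P.rank (n + 1))) := h ▸ Fin.isEmpty
  refine (injective_iff_map_eq_zero _).mpr fun v hv ↦ ?_
  obtain ⟨w, rfl⟩ := (P.exact_d_cover n v).mp hv
  rw [Subsingleton.elim w 0, map_zero]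

theorem subsingleton_ext_syzygy_left {X : Type u} [AddCommGroup X] [Module R X] (n i : ℕ)
    (h : Subsingleton (ExtModule R M X (i + 1 + n))) :
    Subsingleton (ExtModule R (P.syzygy n) X (i + 1)) := by
  induction n generalizing i with
  | zero => exact (subsingleton_ext_congr_left P.syzygyZeroEquiv.toModuleIso).mpr h
  | succ n ih =>
    refine subsingleton_ext_of_contravariant₁ (P.shortExact_syzygy n)
      (subsingleton_ext_of_projective i) (ih (i + 1) ?_)
    rwa [show i + 1 + 1 + n = i + 1 + (n + 1) by lia]

theorem subsingleton_ext_syzygy_right {X : Type u} [AddCommGroup X] [Module R X] {d : ℕ}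
    (hR : ∀ i < d, Subsingleton (ExtModule R X R i))
    (hM : ∀ i < d, Subsingleton (ExtModule R X M i)) (n : ℕ) :
    ∀ i < d, Subsingleton (ExtModule R X (P.syzygy n) i) := by
  induction n with
  | zero =>
    exact fun i hi ↦ (subsingleton_ext_congr_right P.syzygyZeroEquiv.toModuleIso).mpr (hM i hi)
  | succ n ih =>
    exact fun i hi ↦ subsingleton_ext_of_covariant₁ (P.shortExact_syzygy n)
      (fun j hj ↦ ih j (by lia)) (subsingleton_ext_pi (hR i hi))

-- The splitting realises the syzygy as a direct summand of a free module contained in `𝔪` times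
-- that module.
theorem rank_eq_zero_of_subsingleton_ext_one {n : ℕ}
    (h : Subsingleton (ExtModule R (P.syzygy n) (P.syzygy (n + 1)) 1)) :
    P.rank (n + 1) = 0 := by
  obtain ⟨π, hπ⟩ := exists_comp_eq_of_subsingleton_ext_one (P.shortExact_syzygy n) h (𝟙 _)
  have := P.finite_syzygy (n + 1)
  have : Subsingleton (P.syzygy (n + 1)) := by
    refine subsingleton_of_top_le_maximalIdeal_smul (R := R) fun x _ ↦ ?_
    have hx : P.inclusion n x ∈ maximalIdeal R • (⊤ : Submodule R (Fin (P.rank n) → R)) :=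
      P.minimal n (P.range_inclusion n ▸ LinearMap.mem_range_self _ x)
    have hmem := Submodule.mem_map_of_mem (f := π.hom) hx
    rw [Submodule.map_smul'', show π.hom (P.inclusion n x) = x from congr($(hπ).hom x)] at hmem
    exact Submodule.smul_mono le_rfl le_top hmem
  exact P.rank_eq_zero_of_subsingleton_syzygy

end Syzygy

section FiniteLength

variable {R : Type u} [CommRing R] [IsLocalRing R] [IsNoetherianRing R] {M : Type u}
  [AddCommGroup M] [Module R M] (P : MinimalFreeResolution R M) {d : ℕ}

-- The last differential `P.d n` would be injective, yet it acts as zero on `Ext^d(k, -)`, so that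
-- `Ext^d(k, R)` would vanish.
theorem rank_eq_zero_of_rank_succ (hR : depth R R = d)
    (hM : ∀ i < d, Subsingleton (ExtModule R (ResidueField R) M i)) {n : ℕ}
    (h : P.rank (n + 2) = 0) : P.rank (n + 1) = 0 := by
  have hinj : Function.Injective (P.d n) := by
    rw [← P.inclusion_comp_cover]
    exact (P.inclusion_injective n).comp (P.cover_injective h)
  have hS := shortExact_of_exact hinj (P.exact_d_cover n) (P.cover_surjective n)
  have hd : P.d n ∈ Module.annihilator R (ResidueField R) •
      (⊤ : Submodule R ((Fin (P.rank (n + 1)) → R) →ₗ[R] (Fin (P.rank n) → R))) :=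
    mem_smul_top_of_range_le ((P.minimal n).trans_eq (by
      rw [show Module.annihilator R (ResidueField R) = maximalIdeal R from
        Ideal.annihilator_quotient]))
  have hext : Subsingleton (ExtModule R (ResidueField R) (Fin (P.rank (n + 1)) → R) d) :=
    subsingleton_of_forall_eq 0 fun x ↦ ext_eq_zero_of_comp_mk₀_eq_zero hS
      (fun i hi ↦ P.subsingleton_ext_syzygy_right
        (fun j hj ↦ subsingleton_ext_of_lt_depth (hR ▸ by exact_mod_cast hj)) hM n i (by lia))
      (ext_comp_mk₀_eq_zero_of_mem_smul_top hd x)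
  by_contra hr
  have : Nonempty (Fin (P.rank (n + 1))) := ⟨⟨0, Nat.pos_of_ne_zero hr⟩⟩
  exact not_subsingleton_ext_of_depth_eq hR (subsingleton_ext_of_pi hext)

theorem free_of_rank_eq_zero (hR : depth R R = d)
    (hM : ∀ i < d, Subsingleton (ExtModule R (ResidueField R) M i)) {n : ℕ}
    (h : P.rank (n + 1) = 0) : Module.Free R M := by
  have h₁ : P.rank 1 = 0 := by
    induction n with
    | zero => exact h
    | succ n ih => exact ih (P.rank_eq_zero_of_rank_succ hR hM h)
  exact .of_equiv ((LinearEquiv.ofBijective _ ⟨P.cover_injective h₁, P.cover_surjective 0⟩).trans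
    P.syzygyZeroEquiv)

end FiniteLength

end MinimalFreeResolution

section Gorenstein

variable {R : Type u} [CommRing R] [IsLocalRing R]

theorem exists_injective_residueField {M : Type u} [AddCommGroup M] [Module R M]
    (h : ¬ Subsingleton (ExtModule R (ResidueField R) M 0)) :
    ∃ f : ResidueField R →ₗ[R] M, Function.Injective f := by
  rw [subsingleton_ext_zero_iff, not_subsingleton_iff_nontrivial] at h
  obtain ⟨f, hf⟩ := exists_ne (0 : ResidueField R →ₗ[R] M)
  have : IsSimpleModule R (ResidueField R) :=
    isSimpleModule_iff_isCoatom.mpr (maximalIdeal.isMaximal R).out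
  exact ⟨f, (LinearMap.injective_or_eq_zero f).resolve_right hf⟩

namespace IsCanonicalModule

variable {ω : Type u} [AddCommGroup ω] [Module R ω] (hω : IsCanonicalModule R ω) {d : ℕ}
  (hd : ringKrullDim R = d)

include hω hd

theorem subsingleton_ext {i : ℕ} (hi : i ≠ d) :
    Subsingleton (ExtModule R (ResidueField R) ω i) := by
  have hlen := hω.length_ext i
  rw [if_neg (by rw [hd]; exact_mod_cast hi)] at hlen
  exact Module.length_eq_zero_iff.mp hlen

theorem not_subsingleton_ext : ¬ Subsingleton (ExtModule R (ResidueField R) ω d) := by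
  intro h
  have hlen := hω.length_ext d
  rw [if_pos hd.symm, Module.length_eq_zero_iff.mpr h] at hlen
  exact zero_ne_one hlen

end IsCanonicalModule

variable [IsNoetherianRing R] {d : ℕ}

theorem exists_injective_residueField_quotient {rs : List R} (hR : depth R R = rs.length)
    (hmem : ∀ r ∈ rs, r ∈ maximalIdeal R) (hreg : RingTheory.Sequence.IsRegular R rs) :
    ∃ f : ResidueField R →ₗ[R] R ⧸ (Ideal.ofList rs • ⊤ : Submodule R R),
      Function.Injective f := by
  refine exists_injective_residueField fun h ↦ ?_
  have : Nontrivial (R ⧸ (Ideal.ofList rs • ⊤ : Submodule R R)) :=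
    hreg.quot_ofList_smul_nontrivial ⊤
  obtain ⟨as, hlen, has, hreg'⟩ := exists_isRegular_of_subsingleton_ext (n := 1) (R := R)
    (M := R ⧸ (Ideal.ofList rs • ⊤ : Submodule R R))
    fun i hi ↦ by rwa [Nat.lt_one_iff.mp hi]
  have hmem' : ∀ r ∈ rs ++ as, r ∈ maximalIdeal R := fun r hr ↦
    (List.mem_append.mp hr).elim (hmem r) (has r)
  have hreg'' : RingTheory.Sequence.IsRegular R (rs ++ as) :=
    (IsLocalRing.isRegular_iff_isWeaklyRegular_of_subset_maximalIdeal hmem').mpr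
      ((RingTheory.Sequence.isWeaklyRegular_append_iff R rs as).mpr ⟨hreg.1, hreg'.1⟩)
  have hle := length_le_depth hmem' hreg''
  rw [List.length_append, hlen, hR] at hle
  exact absurd (by exact_mod_cast hle) (Nat.lt_succ_self rs.length).not_ge

theorem exists_injective_residueField_of_depth_eq (hR : depth R R = d) :
    ∃ (N : ModuleCat.{u} R) (f : ResidueField R →ₗ[R] N),
      HasProjectiveDimensionLE N d ∧ Function.Injective f := by
  obtain ⟨rs, rfl, hmem, hreg⟩ := exists_isRegular_of_depth_eq hR
  obtain ⟨f, hf⟩ := exists_injective_residueField_quotient hR hmem hreg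
  refine ⟨.of R (R ⧸ (Ideal.ofList rs • ⊤ : Submodule R R)), f, ?_, hf⟩
  have hpd := ModuleCat.projectiveDimension_quotient_eq_add_length_of_isWeaklyRegular
    (ModuleCat.of R R) rs hreg.1 hmem
  rw [ModuleCat.projectiveDimension_eq_zero_of_projective (ModuleCat.of R R), zero_add] at hpd
  exact (projectiveDimension_le_iff _ _).mp hpd.le

variable {K : Type u} [AddCommGroup K] [Module R K] [Module.Finite R K]

-- For `k ↪ N` with `N` of projective dimension at most `d`, the functor `Ext^i(k, K)` is squeezed
-- between `Ext^i(N, K)` and `Ext^{i+1}(N/k, K)`.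
theorem hasInjectiveDimensionLT_of_hasInjectiveDimensionLT_succ (hR : depth R R = d) {n : ℕ}
    (hn : d ≤ n) (h : HasInjectiveDimensionLT (ModuleCat.of R K) (n + 2)) :
    HasInjectiveDimensionLT (ModuleCat.of R K) (n + 1) := by
  obtain ⟨N, f, hN, hf⟩ := exists_injective_residueField_of_depth_eq hR
  refine hasInjectiveDimensionLT_of_subsingleton_ext_residueField fun i hi ↦ ?_
  exact subsingleton_ext_of_contravariant₁
    (shortExact_of_exact hf (LinearMap.exact_map_mkQ_range f) (Submodule.mkQ_surjective _))
    (HasProjectiveDimensionLT.subsingleton _ (d + 1) i (by lia) _)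
    (HasInjectiveDimensionLT.subsingleton _ (n + 2) (i + 1) (by lia) _)

theorem hasInjectiveDimensionLT_depth_succ (hR : depth R R = d) {n : ℕ}
    (h : HasInjectiveDimensionLT (ModuleCat.of R K) n) :
    HasInjectiveDimensionLT (ModuleCat.of R K) (d + 1) := by
  have hdn := hasInjectiveDimensionLT_of_ge (ModuleCat.of R K) n (d + 1 + n) (by lia)
  clear h
  induction n with
  | zero => exact hdn
  | succ n ih =>
    refine ih ?_
    rw [show d + 1 + n = d + n + 1 by lia]
    exact hasInjectiveDimensionLT_of_hasInjectiveDimensionLT_succ hR (by lia)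
      (by rwa [show d + n + 2 = d + 1 + (n + 1) by lia])

omit [Module.Finite R K] in
theorem MinimalFreeResolution.hasInjectiveDimensionLT_syzygy (P : MinimalFreeResolution R K)
    (hR : depth R R = d) (hinjR : HasInjectiveDimensionLT (ModuleCat.of R R) (d + 1))
    (hinjK : HasInjectiveDimensionLT (ModuleCat.of R K) (d + 1)) (n : ℕ) :
    HasInjectiveDimensionLT (P.syzygy n) (d + 1) := by
  induction n with
  | zero =>
    exact (ModuleCat.hasInjectiveDimensionLE_iff_of_linearEquiv P.syzygyZeroEquiv d).mpr hinjK
  | succ n ih =>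
    have := P.finite_syzygy (n + 1)
    have hfree : HasInjectiveDimensionLT (ModuleCat.of R (Fin (P.rank n) → R)) (d + 1) :=
      hasInjectiveDimensionLT_of_subsingleton_ext_quotient _ _ fun I ↦ subsingleton_ext_pi
        (HasInjectiveDimensionLT.subsingleton _ _ _ le_rfl _)
    exact hasInjectiveDimensionLT_depth_succ hR ((P.shortExact_syzygy n).hasInjectiveDimensionLT_X₁
      (d + 1) ih (hasInjectiveDimensionLT_of_ge _ _ _ (Nat.le_succ _)))

variable {ω : Type u} [AddCommGroup ω] [Module R ω] (hω : IsCanonicalModule R ω)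

include hω

theorem IsCanonicalModule.isGorenstein_of_free (hd : ringKrullDim R = d) [Module.Free R ω] :
    IsGorenstein R := by
  have := hω.finite
  have e := (Module.finBasis R ω).equivFun.toModuleIso
  have : Nonempty (Fin (Module.finrank R ω)) := by
    by_contra hempty
    rw [not_nonempty_iff] at hempty
    exact hω.not_subsingleton_ext hd ((subsingleton_ext_congr_right e).mpr
      (subsingleton_ext_pi_iff.mpr inferInstance))
  exact ⟨d, hasInjectiveDimensionLT_of_subsingleton_ext_residueField fun i hi ↦
    subsingleton_ext_of_pi ((subsingleton_ext_congr_right e).mp (hω.subsingleton_ext hd (by lia)))⟩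

theorem IsCanonicalModule.free_of_isGorenstein (hd : ringKrullDim R = d) (hR : depth R R = d)
    (hG : IsGorenstein R) : Module.Free R ω := by
  have := hω.finite
  obtain ⟨P⟩ := nonempty_minimalFreeResolution (R := R) ω
  obtain ⟨n, hn⟩ := hG
  have hinj : HasInjectiveDimensionLT (P.syzygy (d + 1)) (d + 1) :=
    P.hasInjectiveDimensionLT_syzygy hR (hasInjectiveDimensionLT_depth_succ hR hn)
      (hasInjectiveDimensionLT_of_subsingleton_ext_residueField fun i hi ↦
        hω.subsingleton_ext hd (by lia)) (d + 1)
  have hext : Subsingleton (ExtModule R (P.syzygy d) (P.syzygy (d + 1)) 1) :=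
    P.subsingleton_ext_syzygy_left d 0 (hinj.subsingleton _ _ _ (by lia) _)
  exact P.free_of_rank_eq_zero hR (fun i hi ↦ hω.subsingleton_ext hd hi.ne)
    (P.rank_eq_zero_of_subsingleton_ext_one hext)

end Gorenstein

/-! ### Tor groups -/

section Tor

variable {R : Type u} [CommRing R] {W L : Type u} [AddCommGroup W] [Module R W]
  [AddCommGroup L] [Module R L]

theorem subsingleton_tor_iff (Q : ProjectiveResolution (ModuleCat.of R L)) (n : ℕ) :
    Subsingleton (TorModule R W L (n + 1)) ↔
      Function.Exact ((Q.complex.d (n + 2) (n + 1)).hom.lTensor W)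
        ((Q.complex.d (n + 1) n).hom.lTensor W) := by
  rw [← ModuleCat.isZero_iff_subsingleton]
  refine (Q.isoLeftDerivedObj ((MonoidalCategory.tensoringLeft (ModuleCat.{u} R)).obj
    (ModuleCat.of R W)) (n + 1)).isZero_iff.trans ?_
  refine (HomologicalComplex.exactAt_iff_isZero_homology _ _).symm.trans ?_
  rw [HomologicalComplex.exactAt_iff' _ (n + 2) (n + 1) n (by simp) (by simp),
    ShortComplex.ShortExact.moduleCat_exact_iff_function_exact]
  rfl

theorem subsingleton_tor_of_flat [Module.Flat R W] (n : ℕ) :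
    Subsingleton (TorModule R W L (n + 1)) := by
  rw [subsingleton_tor_iff (ProjectiveResolution.of (ModuleCat.of R L))]
  exact Module.Flat.lTensor_exact W
    ((ShortComplex.ShortExact.moduleCat_exact_iff_function_exact _).mp
      ((ProjectiveResolution.of (ModuleCat.of R L)).exact_succ n))

section

variable {A B C D : Type*} [AddCommGroup A] [AddCommGroup B] [AddCommGroup C] [AddCommGroup D]
  [Module R A] [Module R B] [Module R C] [Module R D]

theorem injective_lTensor_subtype_range {N : Type*} [AddCommGroup N] [Module R N] {f : A →ₗ[R] B}
    {g : B →ₗ[R] C} (hgf : g ∘ₗ f = 0) (h : Function.Exact (f.lTensor N) (g.lTensor N)) :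
    Function.Injective ((LinearMap.range g).subtype.lTensor N) := by
  rw [injective_iff_map_eq_zero]
  intro t ht
  obtain ⟨s, rfl⟩ := LinearMap.lTensor_surjective N g.surjective_rangeRestrict t
  rw [← LinearMap.comp_apply, ← LinearMap.lTensor_comp] at ht
  obtain ⟨s, rfl⟩ := (h s).mp ht
  have : g.rangeRestrict ∘ₗ f = 0 := LinearMap.ext fun x ↦ Subtype.ext (DFunLike.congr_fun hgf x)
  rw [← LinearMap.comp_apply, ← LinearMap.lTensor_comp, this, LinearMap.lTensor_zero,
    LinearMap.zero_apply]

theorem injective_lTensor_iff_injective_rTensor [Module.Flat R B] [Module.Flat R D]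
    {f : A →ₗ[R] B} {g : C →ₗ[R] D} (hf : Function.Injective f) (hg : Function.Injective g) :
    Function.Injective (f.lTensor C) ↔ Function.Injective (g.rTensor A) := by
  rw [← (Module.Flat.rTensor_preserves_injective_linearMap (M := B) g hg).of_comp_iff,
    ← (Module.Flat.lTensor_preserves_injective_linearMap (M := D) f hf).of_comp_iff,
    ← LinearMap.coe_comp, ← LinearMap.coe_comp, LinearMap.rTensor_comp_lTensor,
    LinearMap.lTensor_comp_rTensor]

end

namespace MinimalFreeResolution

variable [IsLocalRing R] (P : MinimalFreeResolution R W)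

-- Dimension shifting in both arguments at once: this is the symmetry of `Tor`.
theorem injective_lTensor_inclusion (n : ℕ) (G : ℕ → Type u) [∀ i, AddCommGroup (G i)]
    [∀ i, Module R (G i)] [∀ i, Module.Flat R (G i)] (δ : ∀ i, G (i + 1) →ₗ[R] G i)
    (π : G 0 →ₗ[R] L) (hπ : Function.Surjective π) (h0 : Function.Exact (δ 0) π)
    (hδ : ∀ i, Function.Exact (δ (i + 1)) (δ i))
    (h : Function.Exact ((δ (n + 1)).lTensor W) ((δ n).lTensor W)) :
    Function.Injective ((P.inclusion n).lTensor L) := by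
  have hexact : Function.Exact (LinearMap.range (δ 0)).subtype π := by
    rw [LinearMap.exact_iff, Submodule.range_subtype, LinearMap.exact_iff.mp h0]
  induction n generalizing L G with
  | zero =>
    have hε : Function.Exact (P.inclusion 0) P.ε := by
      rw [LinearMap.exact_iff, P.range_inclusion, LinearMap.exact_iff.mp P.exact_ε]
    refine lTensor_injective_of_exact_of_exact_of_rTensor_injective hexact hπ hε
      P.ε_surjective ((LinearMap.lTensor_inj_iff_rTensor_inj _ _).mp ?_)
      (Module.Flat.lTensor_preserves_injective_linearMap _ (P.inclusion_injective 0))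
    exact injective_lTensor_subtype_range (hδ 0).linearMap_comp_eq_zero h
  | succ n ih =>
    have hker : Function.Exact (δ 1) (δ 0).rangeRestrict := by
      rw [LinearMap.exact_iff, LinearMap.ker_rangeRestrict, LinearMap.exact_iff.mp (hδ 0)]
    have hn : Function.Injective ((P.inclusion n).lTensor (LinearMap.range (δ 0))) :=
      ih (fun i ↦ G (i + 1)) (fun i ↦ δ (i + 1)) (δ 0).rangeRestrict
        (δ 0).surjective_rangeRestrict hker (fun i ↦ hδ (i + 1)) h (by
          rw [LinearMap.exact_iff, Submodule.range_subtype, LinearMap.exact_iff.mp hker])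
    exact lTensor_injective_of_exact_of_exact_of_rTensor_injective hexact hπ
      (P.exact_inclusion_cover (n + 1)) (P.cover_surjective (n + 1))
      ((injective_lTensor_iff_injective_rTensor (P.inclusion_injective n)
        (LinearMap.range (δ 0)).injective_subtype).mp hn)
      (Module.Flat.lTensor_preserves_injective_linearMap _ (P.inclusion_injective (n + 1)))

theorem injective_lTensor_inclusion_of_subsingleton_tor {n : ℕ}
    (h : Subsingleton (TorModule R W L (n + 1))) :
    Function.Injective ((P.inclusion n).lTensor L) := by
  let Q := ProjectiveResolution.of (ModuleCat.of R L)
  have (i : ℕ) : Module.Flat R (Q.complex.X i) := by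
    have : Module.Projective R (Q.complex.X i) :=
      (IsProjective.iff_projective (Q.complex.X i)).mpr (Q.projective i)
    infer_instance
  exact P.injective_lTensor_inclusion n (fun i ↦ Q.complex.X i)
    (fun i ↦ (Q.complex.d (i + 1) i).hom) (Q.π.f 0).hom
    ((ModuleCat.epi_iff_surjective _).mp inferInstance)
    ((ShortComplex.ShortExact.moduleCat_exact_iff_function_exact _).mp Q.exact₀)
    (fun i ↦ (ShortComplex.ShortExact.moduleCat_exact_iff_function_exact _).mp (Q.exact_succ i))
    ((subsingleton_tor_iff Q n).mp h)

theorem exact_lTensor_d {n : ℕ} (h : Subsingleton (TorModule R W L (n + 1))) :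
    Function.Exact ((P.d (n + 1)).lTensor L) ((P.d n).lTensor L) := by
  rw [← P.inclusion_comp_cover n, LinearMap.lTensor_comp,
    (P.injective_lTensor_inclusion_of_subsingleton_tor h).comp_exact_iff_exact]
  exact lTensor_exact L (P.exact_d_cover (n + 1)) (P.cover_surjective (n + 1))

theorem exact_lcomp_d {n : ℕ} (h : Subsingleton (ExtModule R W L (n + 1))) :
    Function.Exact ((P.d n).lcomp R L) ((P.d (n + 1)).lcomp R L) := by
  have hS : Subsingleton (ExtModule R (P.syzygy n) L 1) :=
    P.subsingleton_ext_syzygy_left n 0 (by rwa [zero_add, add_comm])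
  have hsurj : Function.Surjective ((P.inclusion n).lcomp R L) := fun φ ↦ by
    obtain ⟨ψ, hψ⟩ := exists_comp_eq_of_subsingleton_ext_one (P.shortExact_syzygy n) hS
      (ModuleCat.ofHom φ)
    exact ⟨ψ.hom, congr(($hψ).hom)⟩
  have hcomp : (P.d n).lcomp R L =
      (P.cover (n + 1)).lcomp R L ∘ₗ (P.inclusion n).lcomp R L := by
    rw [← P.inclusion_comp_cover n]
    rfl
  rw [hcomp, hsurj.comp_exact_iff_exact]
  exact LinearMap.exact_lcomp_of_exact_of_surjective L (P.exact_d_cover (n + 1))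
    (P.cover_surjective (n + 1))

end MinimalFreeResolution

end Tor

/-! ### Complexes of matrices over a module -/

section MatrixMap

open TensorProduct
open scoped Pointwise

/-- The map `Mⁿ → Mᵐ` that an `m × n` matrix over the base ring induces on powers of a module `M`.
It represents `M ⊗ -` applied to the matrix and, transposed, `Hom(-, M)` applied to it. -/
def matrixMap {R m n : Type*} [CommRing R] [Fintype n] (A : Matrix m n R) (M : Type*)
    [AddCommGroup M] [Module R M] : (n → M) →ₗ[R] (m → M) :=
  LinearMap.pi fun i ↦ ∑ j, A i j • LinearMap.proj j

variable {R : Type*} [CommRing R] {l m n p : Type*} {M : Type*} [AddCommGroup M] [Module R M]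

theorem matrixMap_apply [Fintype n] (A : Matrix m n R) (v : n → M) (i : m) :
    matrixMap A M v i = ∑ j, A i j • v j := by
  simp [matrixMap]

theorem smul_top_pi (x : R) :
    x • (⊤ : Submodule R (n → M)) = Submodule.pi Set.univ fun _ ↦ x • (⊤ : Submodule R M) := by
  ext v
  simp [Submodule.mem_smul_pointwise_iff_exists, funext_iff, Classical.skolem]

section Ladder

variable [Fintype n] [DecidableEq n]

theorem matrixMap_comp_piRight [Fintype m] [DecidableEq m] (A : Matrix m n R) (S : Type*)
    [CommRing S] [Algebra R S] :
    matrixMap (A.map (algebraMap R S)) (S ⊗[R] M) ∘ₗ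
        (TensorProduct.piRight R S S fun _ ↦ M).toLinearMap =
      (TensorProduct.piRight R S S fun _ ↦ M).toLinearMap ∘ₗ (matrixMap A M).baseChange S := by
  refine TensorProduct.AlgebraTensorModule.curry_injective (LinearMap.ext fun s ↦
    LinearMap.ext fun v ↦ funext fun i ↦ ?_)
  simp [matrixMap_apply, TensorProduct.tmul_sum]

theorem matrixMap_comp_piScalarRight [Fintype m] [DecidableEq m] (f : (n → R) →ₗ[R] (m → R)) :
    matrixMap (LinearMap.toMatrix' f) M ∘ₗ (TensorProduct.piScalarRight R R M n).toLinearMap =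
      (TensorProduct.piScalarRight R R M m).toLinearMap ∘ₗ f.lTensor M := by
  refine TensorProduct.ext' fun x v ↦ funext fun i ↦ ?_
  obtain ⟨A, rfl⟩ := LinearMap.toMatrix'.symm.surjective f
  simp [matrixMap_apply, Matrix.mulVec, dotProduct, Finset.sum_smul, mul_smul]

theorem lcomp_comp_piEquiv [Fintype m] (f : (n → R) →ₗ[R] (m → R)) :
    f.lcomp R M ∘ₗ (Module.piEquiv m R M).toLinearMap =
      (Module.piEquiv n R M).toLinearMap ∘ₗ matrixMap (LinearMap.toMatrix' f).transpose M := by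
  refine LinearMap.ext fun v ↦ LinearMap.pi_ext' fun j ↦ LinearMap.ext_ring ?_
  simp [Module.piEquiv_apply_apply, matrixMap_apply, LinearMap.toMatrix'_apply, Pi.single_apply]

/-- Reduction modulo an element commutes with finite powers. -/
noncomputable def quotSMulTopPiEquiv (x : R) (M n : Type*) [AddCommGroup M] [Module R M]
    [Fintype n] [DecidableEq n] : QuotSMulTop x (n → M) ≃ₗ[R] (n → QuotSMulTop x M) :=
  Submodule.quotEquivOfEq _ _ (smul_top_pi x) ≪≫ₗ Submodule.quotientPi _

theorem matrixMap_comp_quotSMulTopPiEquiv [Fintype m] [DecidableEq m] (A : Matrix m n R)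
    (x : R) :
    matrixMap A (QuotSMulTop x M) ∘ₗ (quotSMulTopPiEquiv x M n).toLinearMap =
      (quotSMulTopPiEquiv x M m).toLinearMap ∘ₗ QuotSMulTop.map x (matrixMap A M) := by
  refine Submodule.linearMap_qext _ (LinearMap.ext fun v ↦ funext fun i ↦ ?_)
  simp [quotSMulTopPiEquiv, matrixMap_apply]

end Ladder

variable [Fintype m] [Fintype n]

theorem exact_matrixMap_baseChange [Finite l] {A : Matrix m n R} {B : Matrix l m R} (S : Type*)
    [CommRing S] [Algebra R S] [Module.Flat R S]
    (h : Function.Exact (matrixMap A M) (matrixMap B M)) :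
    Function.Exact (matrixMap (A.map (algebraMap R S)) (S ⊗[R] M))
      (matrixMap (B.map (algebraMap R S)) (S ⊗[R] M)) := by
  classical
  have := Fintype.ofFinite l
  have hS : Function.Exact ((matrixMap A M).baseChange S) ((matrixMap B M).baseChange S) :=
    Module.Flat.lTensor_exact S h
  exact .of_ladder_linearEquiv_of_exact (matrixMap_comp_piRight A S)
    (matrixMap_comp_piRight B S) hS

theorem exact_matrixMap_quotSMulTop [Fintype l] {A : Matrix m n R} {B : Matrix l m R}
    {C : Matrix p l R} {x : R} (hx : IsSMulRegular M x)
    (hAB : Function.Exact (matrixMap A M) (matrixMap B M))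
    (hBC : Function.Exact (matrixMap B M) (matrixMap C M)) :
    Function.Exact (matrixMap A (QuotSMulTop x M)) (matrixMap B (QuotSMulTop x M)) := by
  classical
  exact .of_ladder_linearEquiv_of_exact (matrixMap_comp_quotSMulTopPiEquiv A x)
    (matrixMap_comp_quotSMulTopPiEquiv B x)
    (QuotSMulTop.map_first_exact_on_four_term_exact_of_isSMulRegular_last hAB hBC
      (IsSMulRegular.pi fun _ ↦ hx))

end MatrixMap

section Vanishing

open scoped Pointwise

variable {R : Type*} [CommRing R] {I : Ideal R}

theorem smul_top_quotSMulTop_le {M : Type*} [AddCommGroup M] [Module R M] {x : R} {rs : List R}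
    (h : I • (⊤ : Submodule R M) ≤ Ideal.ofList (x :: rs) • ⊤) :
    I • (⊤ : Submodule R (QuotSMulTop x M)) ≤ Ideal.ofList rs • ⊤ := by
  let q := (x • (⊤ : Submodule R M)).mkQ
  have hq : Submodule.map q ⊤ = ⊤ := by rw [Submodule.map_top, Submodule.range_mkQ]
  have hx : Submodule.map q (x • ⊤) = ⊥ := by
    rw [← LinearMap.le_ker_iff_map, Submodule.ker_mkQ]
  have := Submodule.map_mono (f := q) h
  rwa [Ideal.ofList_cons_smul, Submodule.map_sup, Submodule.map_smul'', Submodule.map_smul'', hq,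
    hx, bot_sup_eq] at this

theorem matrixMap_eq_zero {M : Type*} [AddCommGroup M] [Module R M]
    (hM : I • (⊤ : Submodule R M) = ⊥) {m n : Type*} [Fintype n] {A : Matrix m n R}
    (hA : ∀ i j, A i j ∈ I) : matrixMap A M = 0 := by
  ext v i
  rw [matrixMap_apply]
  refine Finset.sum_eq_zero fun j _ ↦ (Submodule.mem_bot R).mp ?_
  exact hM.le (Submodule.smul_mem_smul (hA i j) Submodule.mem_top)

theorem isEmpty_of_exact_matrixMap {M : Type*} [AddCommGroup M] [Module R M] [Nontrivial M]
    (hM : I • (⊤ : Submodule R M) = ⊥) {l m n : Type*} [Fintype m] [Fintype n]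
    {A : Matrix m n R} {B : Matrix l m R} (hA : ∀ i j, A i j ∈ I) (hB : ∀ i j, B i j ∈ I)
    (h : Function.Exact (matrixMap A M) (matrixMap B M)) : IsEmpty m := by
  rw [matrixMap_eq_zero hM hA, matrixMap_eq_zero hM hB] at h
  by_contra hm
  rw [not_isEmpty_iff] at hm
  obtain ⟨v, hv⟩ := exists_ne (0 : m → M)
  obtain ⟨w, hw⟩ := (h v).mp rfl
  exact hv hw.symm

theorem isEmpty_of_exact_cochain {ι : ℕ → Type*} [∀ i, Fintype (ι i)]
    (A : ∀ i, Matrix (ι (i + 1)) (ι i) R) (hA : ∀ i j k, A i j k ∈ I) (rs : List R) (n : ℕ)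
    (M : Type*) [AddCommGroup M] [Module R M] (hreg : RingTheory.Sequence.IsRegular M rs)
    (hle : I • (⊤ : Submodule R M) ≤ Ideal.ofList rs • ⊤)
    (hex : ∀ i, n ≤ i → i ≤ n + rs.length →
      Function.Exact (matrixMap (A i) M) (matrixMap (A (i + 1)) M)) : IsEmpty (ι (n + 1)) := by
  induction rs generalizing M with
  | nil =>
    have := hreg.nontrivial
    exact isEmpty_of_exact_matrixMap (by simpa using hle) (hA n) (hA (n + 1))
      (hex n le_rfl le_rfl)
  | cons x rs ih =>
    rw [RingTheory.Sequence.isRegular_cons_iff] at hreg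
    rw [List.length_cons] at hex
    exact ih _ hreg.2 (smul_top_quotSMulTop_le hle) fun i hni hin ↦
      exact_matrixMap_quotSMulTop hreg.1 (hex i hni (by lia)) (hex (i + 1) (by lia) (by lia))

theorem isEmpty_of_exact_chain {ι : ℕ → Type*} [∀ i, Fintype (ι i)]
    (A : ∀ i, Matrix (ι i) (ι (i + 1)) R) (hA : ∀ i j k, A i j k ∈ I) (rs : List R) (n : ℕ)
    (M : Type*) [AddCommGroup M] [Module R M] (hreg : RingTheory.Sequence.IsRegular M rs)
    (hle : I • (⊤ : Submodule R M) ≤ Ideal.ofList rs • ⊤)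
    (hex : ∀ i, n ≤ i → i ≤ n + rs.length →
      Function.Exact (matrixMap (A (i + 1)) M) (matrixMap (A i) M)) :
    IsEmpty (ι (n + rs.length + 1)) := by
  induction rs generalizing M n with
  | nil =>
    have := hreg.nontrivial
    exact isEmpty_of_exact_matrixMap (by simpa using hle) (hA (n + 1)) (hA n)
      (hex n le_rfl le_rfl)
  | cons x rs ih =>
    rw [RingTheory.Sequence.isRegular_cons_iff] at hreg
    rw [List.length_cons] at hex ⊢
    rw [show n + (rs.length + 1) + 1 = n + 1 + rs.length + 1 by lia]
    refine ih (n + 1) _ hreg.2 (smul_top_quotSMulTop_le hle) fun i hni hin ↦ ?_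
    obtain ⟨i, rfl⟩ := Nat.exists_eq_succ_of_ne_zero (by lia : i ≠ 0)
    exact exact_matrixMap_quotSMulTop hreg.1 (hex (i + 1) (by lia) (by lia))
      (hex i (by lia) (by lia))

end Vanishing

namespace MinimalFreeResolution

variable {R : Type u} [CommRing R] [IsLocalRing R] {W L : Type u} [AddCommGroup W] [Module R W]
  [AddCommGroup L] [Module R L] (P : MinimalFreeResolution R W)

/-- The matrix of a differential of a free resolution. -/
noncomputable def matrix (n : ℕ) : Matrix (Fin (P.rank n)) (Fin (P.rank (n + 1))) R :=
  LinearMap.toMatrix' (P.d n)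

theorem matrix_mem (n : ℕ) (i j) : P.matrix n i j ∈ maximalIdeal R := by
  rw [matrix, LinearMap.toMatrix'_apply]
  exact mem_smul_top_pi_iff.mp (P.minimal n ⟨_, rfl⟩) i

theorem exact_matrixMap_transpose {n : ℕ} (h : Subsingleton (ExtModule R W L (n + 1))) :
    Function.Exact (matrixMap (P.matrix n).transpose L)
      (matrixMap (P.matrix (n + 1)).transpose L) :=
  (Function.Exact.iff_of_ladder_linearEquiv (lcomp_comp_piEquiv (P.d n))
    (lcomp_comp_piEquiv (P.d (n + 1)))).mp (P.exact_lcomp_d h)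

theorem exact_matrixMap {n : ℕ} (h : Subsingleton (TorModule R W L (n + 1))) :
    Function.Exact (matrixMap (P.matrix (n + 1)) L) (matrixMap (P.matrix n) L) :=
  .of_ladder_linearEquiv_of_exact (matrixMap_comp_piScalarRight (P.d (n + 1)))
    (matrixMap_comp_piScalarRight (P.d n)) (P.exact_lTensor_d h)

end MinimalFreeResolution

/-! ### Superficial sequences and minimal cycles -/

section SuperficialSequence

variable {S : Type*} [CommRing S]

theorem smul_mem_smul_top_of_colon {M : Type*} [AddCommGroup M] [Module S M] [Module.Free S M]
    [Module.Finite S M] {I J : Ideal S} {x : S} (h : ∀ c, x * c ∈ I → c ∈ J) {w : M}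
    (hw : x • w ∈ I • (⊤ : Submodule S M)) : w ∈ J • (⊤ : Submodule S M) := by
  let e := (Module.Free.chooseBasis S M).equivFun
  have hxw : e (x • w) ∈ I • (⊤ : Submodule S (_ → S)) :=
    Submodule.smul_top_le_comap_smul_top I e.toLinearMap hw
  rw [map_smul, mem_smul_top_pi_iff] at hxw
  have hew : e w ∈ J • (⊤ : Submodule S (_ → S)) :=
    mem_smul_top_pi_iff.mpr fun i ↦ h _ (hxw i)
  simpa using Submodule.smul_top_le_comap_smul_top J e.symm.toLinearMap hew

theorem exists_sub_smul_mem_smul_top {M : Type*} [AddCommGroup M] [Module S M] {I : Ideal S}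
    {x : S} {y : M} (hy : y ∈ (I ⊔ Ideal.span {x}) • (⊤ : Submodule S M)) :
    ∃ w, y - x • w ∈ I • (⊤ : Submodule S M) := by
  rw [Submodule.sup_smul, Submodule.ideal_span_singleton_smul] at hy
  obtain ⟨a, ha, _, ⟨w, -, rfl⟩, rfl⟩ := Submodule.mem_sup.mp hy
  exact ⟨w, by simpa using ha⟩

theorem apply_mem_sq_smul_top {M N : Type*} [AddCommGroup M] [Module S M] [AddCommGroup N]
    [Module S N] {I : Ideal S} {f : M →ₗ[S] N} (hf : LinearMap.range f ≤ I • ⊤) {v : M}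
    (hv : v ∈ I • (⊤ : Submodule S M)) : f v ∈ I ^ 2 • (⊤ : Submodule S N) := by
  have := Submodule.mem_map_of_mem (f := f) hv
  rw [Submodule.map_smul'', Submodule.map_top] at this
  rw [pow_two, Submodule.mul_smul]
  exact Submodule.smul_mono le_rfl hf this

/-- In the complex `D` reduced modulo `I`, every cycle in `𝔪 F` is a boundary. -/
def MinimalCyclesAreBoundaries [IsLocalRing S] {F : ℕ → Type*} [∀ n, AddCommGroup (F n)]
    [∀ n, Module S (F n)] (D : ∀ n, F (n + 1) →ₗ[S] F n) (I : Ideal S) : Prop :=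
  ∀ n, ∀ z ∈ maximalIdeal S • (⊤ : Submodule S (F (n + 1))), D n z ∈ I • (⊤ : Submodule S (F n)) →
    ∃ v, z - D (n + 1) v ∈ I • (⊤ : Submodule S (F (n + 1)))

variable [IsLocalRing S]

/-- A sequence of elements of the maximal ideal such that each term is regular modulo `I` and the
previous ones, does not lie in `𝔪 ^ 2` modulo them, and is superficial, in the sense that it can be
cancelled in large powers of `𝔪` modulo them. -/
def IsSuperficialSequence (I : Ideal S) : List S → Prop
  | [] => True
  | x :: rs => x ∈ maximalIdeal S ∧ x ∉ maximalIdeal S ^ 2 ⊔ I ∧ (∀ c, x * c ∈ I → c ∈ I) ∧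
      (∃ j₀, ∀ j, j₀ ≤ j → ∀ c, x * c ∈ maximalIdeal S ^ (j + 1) ⊔ I →
        c ∈ maximalIdeal S ^ j ⊔ I) ∧
      IsSuperficialSequence (I ⊔ Ideal.span {x}) rs

theorem mem_maximalIdeal_of_mul_mem {J : Ideal S} {x : S} (hx : x ∉ J) {c : S} (hc : x * c ∈ J) :
    c ∈ maximalIdeal S := by
  by_contra hu
  exact hx ((J.mul_unit_mem_iff_mem (notMem_maximalIdeal.mp hu)).mp hc)

variable {F : ℕ → Type*} [∀ n, AddCommGroup (F n)] [∀ n, Module S (F n)]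
  {D : ∀ n, F (n + 1) →ₗ[S] F n}

theorem minimalCyclesAreBoundaries_bot (hD : ∀ n, Function.Exact (D (n + 1)) (D n)) :
    MinimalCyclesAreBoundaries D ⊥ := by
  intro n z _ hz
  rw [Submodule.bot_smul, Submodule.mem_bot] at hz
  obtain ⟨v, rfl⟩ := (hD n z).mp hz
  exact ⟨v, by simp⟩

variable [∀ n, Module.Free S (F n)] [∀ n, Module.Finite S (F n)]
  (hmin : ∀ n, LinearMap.range (D n) ≤ maximalIdeal S • ⊤)
  (hD : ∀ n, Function.Exact (D (n + 1)) (D n))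
  (haug : maximalIdeal S • ⊤ ≤ LinearMap.range (D 0))

include hD haug in
theorem MinimalCyclesAreBoundaries.exists_sub_mem {I : Ideal S}
    (h : MinimalCyclesAreBoundaries D I) {x : S} (hreg : ∀ c, x * c ∈ I → c ∈ I) {n : ℕ}
    {z : F (n + 1)} {w : F n} (hw : w ∈ maximalIdeal S • (⊤ : Submodule S (F n)))
    (hzw : D n z - x • w ∈ I • (⊤ : Submodule S (F n))) :
    ∃ v, w - D n v ∈ I • (⊤ : Submodule S (F n)) := by
  cases n with
  | zero =>
    obtain ⟨v, rfl⟩ := haug hw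
    exact ⟨v, by simp⟩
  | succ n =>
    refine h n w hw (smul_mem_smul_top_of_colon hreg ?_)
    have := Submodule.smul_top_le_comap_smul_top I (D n) hzw
    simpa [(hD n).apply_apply_eq_zero] using this

include hmin hD haug

theorem MinimalCyclesAreBoundaries.sup_span {I : Ideal S} (h : MinimalCyclesAreBoundaries D I)
    {x : S} (hx : x ∈ maximalIdeal S) (hx2 : x ∉ maximalIdeal S ^ 2 ⊔ I)
    (hreg : ∀ c, x * c ∈ I → c ∈ I) :
    MinimalCyclesAreBoundaries D (I ⊔ Ideal.span {x}) := by
  intro n z hz hDz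
  obtain ⟨w, hw⟩ := exists_sub_smul_mem_smul_top hDz
  have hxw : x • w ∈ (maximalIdeal S ^ 2 ⊔ I) • (⊤ : Submodule S (F n)) := by
    rw [Submodule.sup_smul, ← sub_sub_cancel (D n z) (x • w)]
    exact sub_mem (Submodule.mem_sup_left (apply_mem_sq_smul_top (hmin n) hz))
      (Submodule.mem_sup_right hw)
  have hwm : w ∈ maximalIdeal S • (⊤ : Submodule S (F n)) :=
    smul_mem_smul_top_of_colon (fun c ↦ mem_maximalIdeal_of_mul_mem hx2) hxw
  obtain ⟨v, hv⟩ := h.exists_sub_mem hD haug hreg hwm hw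
  have hDv : D n (z - x • v) ∈ I • (⊤ : Submodule S (F n)) := by
    have := add_mem hw (Submodule.smul_mem _ x hv)
    rwa [smul_sub, sub_add_sub_cancel, ← map_smul, ← map_sub] at this
  obtain ⟨v', hv'⟩ := h n (z - x • v)
    (sub_mem hz (Submodule.smul_mem_smul hx Submodule.mem_top)) hDv
  refine ⟨v', ?_⟩
  rw [Submodule.sup_smul, ← sub_add_cancel (z - D (n + 1) v') (x • v), sub_right_comm]
  exact Submodule.add_mem_sup hv' (Submodule.smul_mem_smul
    (Ideal.mem_span_singleton_self x) Submodule.mem_top)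

theorem MinimalCyclesAreBoundaries.sup_ofList {rs : List S} {I : Ideal S}
    (h : MinimalCyclesAreBoundaries D I) (hrs : IsSuperficialSequence I rs) :
    MinimalCyclesAreBoundaries D (I ⊔ Ideal.ofList rs) := by
  induction rs generalizing I with
  | nil => simpa using h
  | cons x rs ih =>
    obtain ⟨hx, hx2, hreg, -, hrs⟩ := hrs
    rw [Ideal.ofList_cons, ← sup_assoc]
    exact ih (h.sup_span hmin hD haug hx hx2 hreg) hrs

variable {rs : List S} (hrs : IsSuperficialSequence ⊥ rs)
  (hsq : maximalIdeal S ^ 2 ≤ Ideal.ofList rs)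

include hrs hsq

theorem exists_sub_mem_ofList (n : ℕ) {z : F n}
    (hz : z ∈ maximalIdeal S • (⊤ : Submodule S (F n))) :
    ∃ v, z - D n v ∈ Ideal.ofList rs • (⊤ : Submodule S (F n)) := by
  cases n with
  | zero =>
    obtain ⟨v, rfl⟩ := haug hz
    exact ⟨v, by simp⟩
  | succ n =>
    have h := (minimalCyclesAreBoundaries_bot hD).sup_ofList hmin hD haug hrs
    rw [bot_sup_eq] at h
    exact h n z hz (Submodule.smul_mono hsq le_rfl (apply_mem_sq_smul_top (hmin n) hz))

theorem maximalIdeal_smul_top_le_of_iSup_range {M : Type*} [AddCommGroup M] [Module S M]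
    {ι : Type*} (n : ι → ℕ) (g : ∀ j, F (n j) →ₗ[S] M) (hg : ∀ j, g j ∘ₗ D (n j) = 0)
    (htop : ⨆ j, LinearMap.range (g j) = ⊤) :
    maximalIdeal S • (⊤ : Submodule S M) ≤ Ideal.ofList rs • ⊤ := by
  rw [← htop, Submodule.smul_iSup, htop]
  refine iSup_le fun j ↦ Submodule.smul_le.mpr ?_
  rintro s hs _ ⟨u, rfl⟩
  obtain ⟨v, hv⟩ := exists_sub_mem_ofList hmin hD haug hrs hsq (n j)
    (Submodule.smul_mem_smul hs (Submodule.mem_top (x := u)))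
  have hgD : g j (D (n j) v) = 0 := congr($(hg j) v)
  rw [← map_smul, ← sub_zero (g j (s • u)), ← hgD, ← map_sub]
  exact Submodule.smul_top_le_comap_smul_top _ (g j) hv

end SuperficialSequence

section BaseChange

open TensorProduct

variable {R : Type*} [CommRing R] (S : Type*) [CommRing S] [Algebra R S] {M N : Type*}
  [AddCommGroup M] [Module R M] [AddCommGroup N] [Module R N]

theorem baseChange_smul_top (I : Ideal R) :
    (I • (⊤ : Submodule R M)).baseChange S = I.map (algebraMap R S) • ⊤ := by
  rw [← Submodule.baseChange_top, ← Submodule.span_univ, Submodule.baseChange_span, Ideal.map,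
    Submodule.span_smul_span]
  conv_lhs => rw [← I.span_eq, Submodule.span_smul_span, Submodule.baseChange_span]
  congr 1
  ext y
  simp [Set.mem_smul]

theorem range_baseChange (f : M →ₗ[R] N) :
    LinearMap.range (f.baseChange S) = (LinearMap.range f).baseChange S := by
  have hf : f.baseChange S =
      (LinearMap.range f).subtype.baseChange S ∘ₗ f.rangeRestrict.baseChange S := by
    rw [← LinearMap.baseChange_comp, LinearMap.subtype_comp_codRestrict]
  rw [hf, LinearMap.range_comp_of_range_eq_top, Submodule.baseChange]
  exact LinearMap.range_eq_top.mpr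
    (LinearMap.lTensor_surjective S f.surjective_rangeRestrict)

theorem iSup_baseChange {ι : Type*} (p : ι → Submodule R M) :
    ⨆ j, (p j).baseChange S = (⨆ j, p j).baseChange S := by
  simp_rw [Submodule.iSup_eq_span p, Submodule.baseChange_span, Set.image_iUnion,
    Submodule.span_iUnion, ← Submodule.baseChange_span, Submodule.span_eq]

end BaseChange

section BaseChangeSyzygy

open TensorProduct

variable {R : Type u} [CommRing R] [IsLocalRing R]

theorem MinimalFreeResolution.maximalIdeal_smul_top_le_range
    (P : MinimalFreeResolution R (ResidueField R)) :
    maximalIdeal R • ⊤ ≤ LinearMap.range (P.d 0) := by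
  refine Submodule.smul_le.mpr fun r hr v _ ↦ (P.exact_ε _).mp ?_
  rw [map_smul]
  exact Module.mem_annihilator.mp ((Ideal.annihilator_quotient (I := maximalIdeal R)).ge hr) _

theorem IsImageOfResidueFieldSyzygies.exists_iSup_range {L : Type u} [AddCommGroup L] [Module R L]
    (hL : IsImageOfResidueFieldSyzygies R L) :
    ∃ (P : MinimalFreeResolution R (ResidueField R)) (t : ℕ) (n : Fin t → ℕ)
      (g : ∀ j, (Fin (P.rank (n j)) → R) →ₗ[R] L),
      (∀ j, g j ∘ₗ P.d (n j) = 0) ∧ ⨆ j, LinearMap.range (g j) = ⊤ := by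
  obtain ⟨P, t, n, f, hf⟩ := hL
  refine ⟨P, t, n, fun j ↦ f ∘ₗ LinearMap.single R (fun j ↦ P.syzygy (n j)) j ∘ₗ P.cover (n j),
    fun j ↦ ?_, ?_⟩
  · rw [LinearMap.comp_assoc, LinearMap.comp_assoc, (P.exact_d_cover _).linearMap_comp_eq_zero,
      LinearMap.comp_zero, LinearMap.comp_zero]
  · refine eq_top_iff.mpr fun y _ ↦ ?_
    obtain ⟨v, rfl⟩ := hf y
    rw [← Finset.univ_sum_single v, map_sum]
    refine Submodule.sum_mem _ fun j _ ↦ Submodule.mem_iSup_of_mem j ?_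
    obtain ⟨w, hw⟩ := P.cover_surjective (n j) (v j)
    exact ⟨w, congr(f (Pi.single j $hw))⟩

variable {S : Type*} [CommRing S] [IsLocalRing S] [Algebra R S] [Module.Flat R S]

theorem IsImageOfResidueFieldSyzygies.maximalIdeal_smul_top_le {L : Type u} [AddCommGroup L]
    [Module R L] (hL : IsImageOfResidueFieldSyzygies R L)
    (hm : (maximalIdeal R).map (algebraMap R S) = maximalIdeal S) {rs : List S}
    (hrs : IsSuperficialSequence ⊥ rs) (hsq : maximalIdeal S ^ 2 ≤ Ideal.ofList rs) :
    maximalIdeal S • (⊤ : Submodule S (S ⊗[R] L)) ≤ Ideal.ofList rs • ⊤ := by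
  obtain ⟨P, t, n, g, hg, htop⟩ := hL.exists_iSup_range
  refine maximalIdeal_smul_top_le_of_iSup_range (F := fun n ↦ S ⊗[R] (Fin (P.rank n) → R))
    (D := fun n ↦ (P.d n).baseChange S)
    (fun i ↦ ?_) (fun i ↦ Module.Flat.lTensor_exact S (P.exact_d i)) ?_ hrs hsq n
    (fun j ↦ (g j).baseChange S) (fun j ↦ ?_) ?_
  · rw [range_baseChange, ← hm, ← baseChange_smul_top]
    exact Submodule.baseChange_mono S (P.minimal i)
  · rw [range_baseChange, ← hm, ← baseChange_smul_top]
    exact Submodule.baseChange_mono S P.maximalIdeal_smul_top_le_range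
  · rw [← LinearMap.baseChange_comp, hg, LinearMap.baseChange_zero]
  · simp_rw [range_baseChange]
    rw [iSup_baseChange, htop, Submodule.baseChange_top]

end BaseChangeSyzygy

/-! ### Lengths and minimal multiplicity -/

section Length

variable {S : Type*} [CommRing S]

theorem length_quotient_add {A B : Ideal S} {x : S} (h : ∀ c, x * c ∈ B ↔ c ∈ A) :
    Module.length S (S ⧸ A) + Module.length S (S ⧸ B ⊔ Ideal.span {x}) =
      Module.length S (S ⧸ B) :=
  (Module.length_eq_add_of_exact _ _ (mulQuotient_injective h) (Submodule.factor_surjective _)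
    (exact_mulQuotient fun c ↦ (h c).mpr)).symm

theorem length_quotient_anti {A B : Ideal S} (h : A ≤ B) :
    Module.length S (S ⧸ B) ≤ Module.length S (S ⧸ A) :=
  Module.length_le_of_surjective (Submodule.factor h) (Submodule.factor_surjective h)

theorem eq_of_length_quotient_le {A B : Ideal S} (h : A ≤ B)
    (hfin : Module.length S (S ⧸ B) ≠ ⊤)
    (hle : Module.length S (S ⧸ A) ≤ Module.length S (S ⧸ B)) : A = B := by
  simp only [Module.length_quotient] at hfin hle
  by_contra hne
  exact (Order.coheight_strictAnti (lt_of_le_of_ne h hne) hfin.lt_top).not_ge hle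

variable [IsLocalRing S]

theorem length_quotient_maximalIdeal : Module.length S (S ⧸ maximalIdeal S) = 1 := by
  have : IsSimpleModule S (S ⧸ maximalIdeal S) :=
    isSimpleModule_iff_isCoatom.mpr (maximalIdeal.isMaximal S).out
  exact Module.length_eq_one S _

theorem length_quotient_le_add_one {B : Ideal S} {x : S}
    (h : ∀ c ∈ maximalIdeal S, x * c ∈ B) :
    Module.length S (S ⧸ B) ≤ Module.length S (S ⧸ B ⊔ Ideal.span {x}) + 1 := by
  rw [← length_quotient_add (A := Submodule.comap (LinearMap.mulLeft S x) B) fun c ↦ Iff.rfl,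
    add_comm, ← length_quotient_maximalIdeal (S := S)]
  gcongr
  exact length_quotient_anti h

theorem length_quotient_le_add_length {I : Ideal S} {rs : List S}
    (hrs : ∀ x ∈ rs, x ∈ maximalIdeal S) (hI : maximalIdeal S ^ 2 ≤ I) :
    Module.length S (S ⧸ I) ≤ Module.length S (S ⧸ I ⊔ Ideal.ofList rs) + rs.length := by
  induction rs generalizing I with
  | nil => rw [Ideal.ofList_nil, sup_bot_eq, List.length_nil, Nat.cast_zero, add_zero]
  | cons x rs ih =>
    rw [List.forall_mem_cons] at hrs
    rw [Ideal.ofList_cons, ← sup_assoc, List.length_cons, Nat.cast_add, Nat.cast_one, ← add_assoc]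
    refine (length_quotient_le_add_one (x := x) fun c hc ↦ hI ?_).trans ?_
    · rw [pow_two]
      exact Ideal.mul_mem_mul hrs.1 hc
    · gcongr
      exact ih hrs.2 (le_sup_of_le_left hI)

theorem length_quotient_sq [IsNoetherianRing S] :
    Module.length S (S ⧸ maximalIdeal S ^ 2) = (maximalIdeal S).spanFinrank + 1 := by
  have hle : maximalIdeal S ^ 2 ≤ maximalIdeal S := Ideal.pow_le_self two_ne_zero
  have hexact : Function.Exact (maximalIdeal S).cotangentToQuotientSquare
      (Submodule.factor hle) := by
    rw [LinearMap.exact_iff, Ideal.range_cotangentToQuotientSquare]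
    ext ⟨c⟩
    exact Submodule.Quotient.mk_eq_zero _ |>.trans Ideal.mk_mem_cotangentIdeal.symm
  rw [Module.length_eq_add_of_exact _ _ (maximalIdeal S).cotangentToQuotientSquare_injective
    (Submodule.factor_surjective hle) hexact, length_quotient_maximalIdeal,
    spanFinrank_maximalIdeal_eq_finrank_cotangentSpace, ← Module.length_eq_finrank]
  exact congrArg (· + 1)
    (Module.length_eq_of_surjective (M := (maximalIdeal S).Cotangent) residue_surjective)

theorem length_quotient_ne_top [IsNoetherianRing S] {J : Ideal S} {n : ℕ}
    (hJ : maximalIdeal S ^ n ≤ J) : Module.length S (S ⧸ J) ≠ ⊤ := by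
  rcases eq_or_ne J ⊤ with rfl | hne
  · simp [Module.length_eq_zero]
  have : Nontrivial (S ⧸ J) := Ideal.Quotient.nontrivial_iff.mpr hne
  have : IsLocalRing (S ⧸ J) := .of_surjective' _ Ideal.Quotient.mk_surjective
  have hnil : IsNilpotent (maximalIdeal (S ⧸ J)) := by
    refine ⟨n, ?_⟩
    rw [← IsLocalRing.map_maximalIdeal_of_surjective _ (Ideal.Quotient.mk_surjective (I := J)),
      ← Ideal.map_pow]
    exact Ideal.map_mk_eq_bot_of_le hJ
  have := (isArtinianRing_iff_isNilpotent_maximalIdeal (S ⧸ J)).mpr hnil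
  rw [Module.length_eq_of_surjective (M := S ⧸ J) (Ideal.Quotient.mk_surjective (I := J))]
  exact Module.length_ne_top

namespace IsSuperficialSequence

theorem forall_mem {I : Ideal S} {rs : List S} (h : IsSuperficialSequence I rs) :
    ∀ x ∈ rs, x ∈ maximalIdeal S := by
  induction rs generalizing I with
  | nil => simp
  | cons x rs ih =>
    rw [List.forall_mem_cons]
    exact ⟨h.1, ih h.2.2.2.2⟩

theorem exists_length_mul_choose_le {I : Ideal S} {rs : List S} (h : IsSuperficialSequence I rs)
    {C : ℕ} (hC : maximalIdeal S ^ C ≤ I ⊔ Ideal.ofList rs) :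
    ∃ C, ∀ j : ℕ, Module.length S (S ⧸ I ⊔ Ideal.ofList rs) * (j.choose rs.length : ℕ) ≤
      Module.length S (S ⧸ maximalIdeal S ^ (C + j) ⊔ I) := by
  induction rs generalizing I with
  | nil =>
    refine ⟨C, fun j ↦ ?_⟩
    rw [Ideal.ofList_nil, sup_bot_eq] at hC ⊢
    rw [List.length_nil, Nat.choose_zero_right, Nat.cast_one, mul_one]
    exact length_quotient_anti
      (sup_le ((Ideal.pow_le_pow_right (Nat.le_add_right C j)).trans hC) le_rfl)
  | cons x rs ih =>
    obtain ⟨hx, -, -, ⟨j₀, hj₀⟩, h⟩ := h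
    rw [Ideal.ofList_cons, ← sup_assoc] at hC ⊢
    obtain ⟨C₁, hC₁⟩ := ih h hC
    refine ⟨C₁ + j₀, fun j ↦ ?_⟩
    induction j with
    | zero => simp
    | succ j hj =>
      have hmul (c : S) : x * c ∈ maximalIdeal S ^ (C₁ + j₀ + j + 1) ⊔ I ↔
          c ∈ maximalIdeal S ^ (C₁ + j₀ + j) ⊔ I := by
        refine ⟨hj₀ _ (by lia) c, fun hc ↦ ?_⟩
        obtain ⟨a, ha, b, hb, rfl⟩ := Submodule.mem_sup.mp hc
        rw [mul_add, pow_succ']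
        exact Submodule.add_mem_sup (Ideal.mul_mem_mul hx ha) (Ideal.mul_mem_left _ _ hb)
      have hquot := hC₁ (j₀ + j + 1)
      rw [show C₁ + (j₀ + j + 1) = C₁ + j₀ + j + 1 by lia, ← sup_assoc] at hquot
      rw [← add_assoc, ← length_quotient_add hmul, List.length_cons, Nat.choose_succ_succ,
        Nat.cast_add, mul_add, add_comm]
      refine add_le_add hj (le_trans ?_ hquot)
      gcongr
      lia

end IsSuperficialSequence

end Length

theorem sub_pow_le_factorial_mul_choose {C d n : ℕ} (hn : C + d ≤ n) :
    ((n : ℝ) - (C + d)) ^ d ≤ d.factorial * (n - C).choose d := by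
  rw [← Nat.cast_add, ← Nat.cast_sub hn]
  have h : (n - C + 1 - d) ^ d ≤ d.factorial * (n - C).choose d :=
    (Nat.pow_sub_le_descFactorial (n - C) d).trans_eq
      (Nat.descFactorial_eq_factorial_mul_choose _ _)
  exact_mod_cast (Nat.pow_le_pow_left (by lia) d).trans h

theorem le_of_tendsto_factorial_mul_div_pow {l C d : ℕ} {a : ℕ → ℕ} {e : ℝ}
    (h : ∀ j, l * j.choose d ≤ a (C + j))
    (ha : Filter.Tendsto (fun n : ℕ ↦ (d.factorial : ℝ) * (a n : ℝ) / (n : ℝ) ^ d)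
      Filter.atTop (nhds e)) : (l : ℝ) ≤ e := by
  have hlim : Filter.Tendsto (fun n : ℕ ↦ (l : ℝ) * (1 - ((C : ℝ) + d) / n) ^ d)
      Filter.atTop (nhds l) := by
    simpa using (((tendsto_const_div_atTop_nhds_zero_nat ((C : ℝ) + d)).const_sub 1).pow
      d).const_mul (l : ℝ)
  refine le_of_tendsto_of_tendsto hlim ha ?_
  filter_upwards [Filter.eventually_ge_atTop (C + d + 1)] with n hn
  have hn0 : (n : ℝ) ≠ 0 := by norm_cast; lia
  have hl : (l * (n - C).choose d : ℝ) ≤ a n := by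
    simpa [show C + (n - C) = n by lia] using (Nat.cast_le (α := ℝ)).mpr (h (n - C))
  rw [one_sub_div hn0, div_pow, ← mul_div_assoc]
  refine div_le_div_of_nonneg_right ?_ (by positivity)
  calc (l : ℝ) * ((n : ℝ) - (C + d)) ^ d
      ≤ l * (d.factorial * (n - C).choose d) := by
        gcongr
        exact sub_pow_le_factorial_mul_choose (by lia)
    _ = d.factorial * (l * (n - C).choose d) := by ring
    _ ≤ d.factorial * a n := by gcongr

section MinimalMultiplicity

theorem IsSuperficialSequence.maximalIdeal_sq_le {S : Type u} [CommRing S] [IsLocalRing S]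
    [IsNoetherianRing S] (hmin : HasMinimalMultiplicity S) {rs : List S}
    (hrs : IsSuperficialSequence ⊥ rs) (hdim : ringKrullDim S = rs.length) {C : ℕ}
    (hC : maximalIdeal S ^ C ≤ Ideal.ofList rs) : maximalIdeal S ^ 2 ≤ Ideal.ofList rs := by
  obtain ⟨d, hd, d', hd', hlim⟩ := hmin
  obtain rfl : rs.length = d' := by exact_mod_cast hdim.symm.trans hd'
  obtain rfl : rs.length = d := by exact_mod_cast hdim.symm.trans hd
  obtain ⟨l, hl⟩ := ENat.ne_top_iff_exists.mp (length_quotient_ne_top hC)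
  obtain ⟨m, hm⟩ := ENat.ne_top_iff_exists.mp
    (length_quotient_ne_top (hC.trans (le_sup_right : _ ≤ maximalIdeal S ^ 2 ⊔ _)))
  have hle : (l : ℝ) ≤ (maximalIdeal S).spanFinrank - rs.length + 1 := by
    obtain ⟨C', hC'⟩ := hrs.exists_length_mul_choose_le (hC.trans le_sup_right)
    refine le_of_tendsto_factorial_mul_div_pow (C := C') (fun j ↦ ?_) hlim
    have h := hC' j
    rw [bot_sup_eq, sup_bot_eq, ← hl] at h
    have hfin := length_quotient_ne_top (le_refl (maximalIdeal S ^ (C' + j)))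
    exact ENat.natCast_le_natCast.mp (h.trans_eq (ENat.natCast_toNat hfin).symm)
  have hsq : (maximalIdeal S).spanFinrank + 1 ≤ m + rs.length := by
    have h := length_quotient_le_add_length hrs.forall_mem le_rfl
    rw [length_quotient_sq, ← hm] at h
    exact_mod_cast h
  refine right_eq_sup.mp (eq_of_length_quotient_le le_sup_right (hm ▸ ENat.natCast_ne_top m) ?_)
  rw [← hl, ← hm, ENat.natCast_le_natCast]
  have : (l : ℝ) + rs.length ≤ (maximalIdeal S).spanFinrank + 1 := by linarith
  norm_cast at this
  lia

variable {R S : Type u} [CommRing R] [IsLocalRing R] [CommRing S] [IsLocalRing S] [Algebra R S]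
  [Module.Flat R S]

theorem length_quotient_pow_eq (hm : (maximalIdeal R).map (algebraMap R S) = maximalIdeal S)
    (n : ℕ) : Module.length S (S ⧸ maximalIdeal S ^ n) =
      Module.length R (R ⧸ maximalIdeal R ^ n) := by
  have : IsLocalHom (algebraMap R S) :=
    ((IsLocalRing.local_hom_TFAE (algebraMap R S)).out 2 0).mp hm.le
  rw [← hm, ← Ideal.map_pow,
    (Algebra.TensorProduct.quotIdealMapEquivTensorQuot S
      (maximalIdeal R ^ n)).toLinearEquiv.length_eq, IsLocalRing.length_baseChange, hm,
    length_quotient_maximalIdeal, mul_one]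

variable [IsNoetherianRing R] [IsNoetherianRing S]

theorem ringKrullDim_eq_of_flat (hm : (maximalIdeal R).map (algebraMap R S) = maximalIdeal S) :
    ringKrullDim S = ringKrullDim R := by
  have : (maximalIdeal S).LiesOver (maximalIdeal R) :=
    ⟨(maximalIdeal.isMaximal R).eq_of_le (Ideal.comap_ne_top _ (maximalIdeal.isMaximal S).ne_top)
      (Ideal.map_le_iff_le_comap.mp hm.le)⟩
  have hheight := Ideal.height_eq_height_add_of_liesOver_of_hasGoingDown (maximalIdeal R)
    (maximalIdeal S)
  rw [hm, Ideal.map_quotient_self, Ideal.height_bot, add_zero] at hheight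
  rw [← maximalIdeal_height_eq_ringKrullDim, ← maximalIdeal_height_eq_ringKrullDim, hheight]

theorem HasMinimalMultiplicity.of_flat (h : HasMinimalMultiplicity R)
    (hm : (maximalIdeal R).map (algebraMap R S) = maximalIdeal S) : HasMinimalMultiplicity S := by
  have hrank : (maximalIdeal S).spanFinrank = (maximalIdeal R).spanFinrank := by
    have := length_quotient_pow_eq hm 2
    rw [length_quotient_sq, length_quotient_sq] at this
    exact Nat.add_right_cancel (mod_cast this)
  simpa only [HasMinimalMultiplicity, HasMultiplicity, ringKrullDim_eq_of_flat hm, hrank,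
    length_quotient_pow_eq hm] using h

end MinimalMultiplicity

/-! ### Existence of superficial elements -/

section Avoidance

variable {S : Type*} [CommRing S] [IsLocalRing S] [IsNoetherianRing S]

theorem maximalIdeal_le_of_le_sq_sup {V : Ideal S}
    (h : maximalIdeal S ≤ maximalIdeal S ^ 2 ⊔ V) : maximalIdeal S ≤ V := by
  refine Submodule.le_of_le_smul_of_le_jacobson_bot (I := maximalIdeal S)
    (IsNoetherian.noetherian _) (IsLocalRing.jacobson_eq_maximalIdeal _ bot_ne_top).ge ?_
  rwa [smul_eq_mul, ← pow_two, sup_comm]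

/-- The image of an ideal in the cotangent space of a local ring, as a subspace over the residue
field. -/
noncomputable def cotangentImage (V : Ideal S) : Subspace (ResidueField S) (CotangentSpace S) :=
  Submodule.span (ResidueField S) ((maximalIdeal S).toCotangent '' {y | (y : S) ∈ V})

theorem maximalIdeal_le_of_cotangentImage_eq_top {V : Ideal S} (h : cotangentImage V = ⊤) :
    maximalIdeal S ≤ V := by
  refine maximalIdeal_le_of_le_sq_sup fun x hx ↦ ?_
  let V' : Submodule S (maximalIdeal S) := Submodule.comap (maximalIdeal S).subtype V
  have hspan : Submodule.map (maximalIdeal S).toCotangent V' = ⊤ := by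
    rw [← Submodule.span_eq (Submodule.map (maximalIdeal S).toCotangent V')]
    have := congrArg (Submodule.restrictScalars S) h
    rwa [cotangentImage, Submodule.restrictScalars_span S (ResidueField S) residue_surjective,
      Submodule.restrictScalars_top] at this
  obtain ⟨y, hy, hxy⟩ := hspan.ge (Submodule.mem_top (x := (maximalIdeal S).toCotangent ⟨x, hx⟩))
  rw [← sub_add_cancel x y]
  exact Submodule.add_mem_sup ((maximalIdeal S).toCotangent_eq.mp hxy.symm) hy

-- The images of the ideals in the cotangent space are finitely many proper subspaces of a vector
-- space over an infinite field.
theorem exists_mem_maximalIdeal_forall_notMem [Infinite (ResidueField S)] {T : Set (Ideal S)}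
    (hT : T.Finite) (h : ∀ V ∈ T, ¬ maximalIdeal S ≤ V) :
    ∃ x ∈ maximalIdeal S, ∀ V ∈ T, x ∉ V := by
  have hW : ⊤ ∉ (hT.image cotangentImage).toFinset := by
    rw [Set.Finite.mem_toFinset]
    rintro ⟨V, hV, hVtop⟩
    exact h V hV (maximalIdeal_le_of_cotangentImage_eq_top hVtop)
  obtain ⟨v, hv⟩ := (Set.ne_univ_iff_exists_notMem _).mp
    (Subspace.biUnion_ne_univ_of_top_notMem hW)
  obtain ⟨x, rfl⟩ := (maximalIdeal S).toCotangent_surjective v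
  refine ⟨x, x.2, fun V hV hx ↦ hv ?_⟩
  exact Set.mem_biUnion ((hT.image cotangentImage).mem_toFinset.mpr ⟨V, hV, rfl⟩)
    (Submodule.subset_span ⟨x, hx, rfl⟩)

end Avoidance

section AssociatedPrimes

variable {A : Type*} [CommRing A] [IsNoetherianRing A]

theorem isSMulRegular_of_forall_notMem_associatedPrimes {M : Type*} [AddCommGroup M] [Module A M]
    {x : A} (h : ∀ P ∈ associatedPrimes A M, x ∉ P) : IsSMulRegular M x := by
  by_contra hreg
  have hx : x ∈ ⋃ P ∈ associatedPrimes A M, (P : Set A) := by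
    rwa [biUnion_associatedPrimes_eq_compl_regular]
  obtain ⟨P, hP, hxP⟩ := Set.mem_iUnion₂.mp hx
  exact h P hP hxP

theorem mem_of_mul_mem_of_forall_notMem_associatedPrimes {J : Ideal A} {x c : A}
    (h : ∀ P ∈ associatedPrimes A (A ⧸ J), x ∉ P) (hc : x * c ∈ J) : c ∈ J :=
  (isSMulRegular_quotient_iff_mem_of_smul_mem J x).mp
    (isSMulRegular_of_forall_notMem_associatedPrimes h) c hc

theorem exists_notMem_of_mem_associatedPrimes {J P : Ideal A}
    (hP : P ∈ associatedPrimes A (A ⧸ J)) : ∃ f ∉ J, ∀ g ∈ P, g * f ∈ J := by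
  obtain ⟨hprime, x, hx⟩ := isAssociatedPrime_iff.mp hP
  obtain ⟨f, rfl⟩ := Submodule.mkQ_surjective J x
  have hf (g : A) : g ∈ P ↔ g * f ∈ J := by
    rw [hx, Submodule.mem_colon_singleton, Submodule.mem_bot, ← map_smul, Submodule.mkQ_apply,
      Submodule.Quotient.mk_eq_zero, smul_eq_mul]
  refine ⟨f, fun hfJ ↦ hprime.ne_top ((Ideal.eq_top_iff_one _).mpr ((hf 1).mpr ?_)),
    fun g ↦ (hf g).mp⟩
  rwa [one_mul]

end AssociatedPrimes

section ReesAlgebra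

open Polynomial

variable {S : Type*} [CommRing S] {I J : Ideal S}

theorem mul_mem_pow_sup {a c : S} {m n k : ℕ} (ha : a ∈ J ^ m) (hc : c ∈ J ^ n ⊔ I)
    (hk : k ≤ m + n) : a * c ∈ J ^ k ⊔ I := by
  obtain ⟨e, he, b, hb, rfl⟩ := Submodule.mem_sup.mp hc
  rw [mul_add]
  refine Submodule.add_mem_sup (Ideal.pow_le_pow_right hk ?_) (Ideal.mul_mem_left _ _ hb)
  rw [pow_add]
  exact Ideal.mul_mem_mul ha he

theorem forall_mem_pow_mul_mem {c : S} {a b k : ℕ}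
    (h : ∀ x ∈ J ^ a, ∀ y ∈ J ^ b, x * y * c ∈ J ^ k ⊔ I) :
    ∀ z ∈ J ^ (a + b), z * c ∈ J ^ k ⊔ I := by
  intro z hz
  rw [pow_add] at hz
  refine Submodule.mul_induction_on hz h fun x y hx hy ↦ ?_
  rw [add_mul]
  exact add_mem hx hy

/-- The ideal of the Rees algebra of `J` consisting of the elements whose image in the associated
graded ring of `S ⧸ I` is annihilated by a power of the irrelevant ideal. -/
def reesTorsion (J I : Ideal S) : Ideal (reesAlgebra J) where
  carrier := {f | ∃ N : ℕ, ∀ u, ∀ a ∈ J ^ N, a * (f : S[X]).coeff u ∈ J ^ (N + u + 1) ⊔ I}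
  zero_mem' := ⟨0, fun u a _ ↦ by simp⟩
  add_mem' := by
    rintro f g ⟨N, hN⟩ ⟨M, hM⟩
    refine ⟨N + M, fun u ↦ forall_mem_pow_mul_mem fun x hx y hy ↦ ?_⟩
    rw [Subalgebra.coe_add, coeff_add, mul_add, mul_assoc x y (coeff g.1 u), mul_right_comm,
      mul_comm]
    exact add_mem (mul_mem_pow_sup hy (hN u x hx) (by lia))
      (mul_mem_pow_sup hx (hM u y hy) (by lia))
  smul_mem' := by
    rintro g f ⟨N, hN⟩
    refine ⟨N, fun u a ha ↦ ?_⟩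
    rw [smul_eq_mul, Subalgebra.coe_mul, coeff_mul, Finset.mul_sum]
    refine sum_mem fun p hp ↦ ?_
    have hp := Finset.HasAntidiagonal.mem_antidiagonal.mp hp
    rw [mul_left_comm]
    exact mul_mem_pow_sup (g.2 p.1) (hN p.2 a ha) (by lia)

/-- The linear map `a ↦ a tⁿ` from `Jⁿ` to the Rees algebra of `J`. -/
noncomputable def reesMonomial (J : Ideal S) (n : ℕ) : ↥(J ^ n) →ₗ[S] reesAlgebra J :=
  LinearMap.codRestrict (Subalgebra.toSubmodule (reesAlgebra J))
    (monomial n ∘ₗ (J ^ n).subtype) fun a ↦ reesAlgebra.monomial_mem.mpr a.2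

theorem coe_reesMonomial {n : ℕ} (a : ↥(J ^ n)) : (reesMonomial J n a : S[X]) = monomial n a.1 :=
  rfl

theorem coeff_reesMonomial_mul {n : ℕ} (a : ↥(J ^ n)) (f : reesAlgebra J) (u : ℕ) :
    ((reesMonomial J n a * f : reesAlgebra J) : S[X]).coeff (u + n) = a * (f : S[X]).coeff u :=
  coeff_monomial_mul _ _ _ _

/-- The ideal of the elements `x ∈ J` such that `x t` lies in the ideal `P` of the Rees algebra. -/
noncomputable def reesDegreeOne (P : Ideal (reesAlgebra J)) : Ideal S :=
  ((P.restrictScalars S).comap (reesMonomial J 1)).map (J ^ 1).subtype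

theorem coe_mem_reesDegreeOne {P : Ideal (reesAlgebra J)} (x : ↥(J ^ 1)) :
    (x : S) ∈ reesDegreeOne P ↔ reesMonomial J 1 x ∈ P :=
  (J ^ 1).subtype_injective.mem_set_image

variable [IsNoetherianRing S]

theorem exists_forall_coeff_mem_of_mem_reesTorsion (J I : Ideal S) :
    ∃ u₀, ∀ f ∈ reesTorsion J I, ∀ u, u₀ ≤ u → (f : S[X]).coeff u ∈ J ^ (u + 1) ⊔ I := by
  obtain ⟨s, hs⟩ := IsNoetherian.noetherian (reesTorsion J I)
  have hmem (f : s) : f.1 ∈ reesTorsion J I := hs ▸ Submodule.subset_span f.2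
  choose N hN using hmem
  refine ⟨s.attach.sup fun f ↦ N f + (f.1 : S[X]).natDegree, fun f hf u hu ↦ ?_⟩
  rw [← hs] at hf
  induction hf using Submodule.closure_induction with
  | zero => simp
  | add x y _ _ hx hy => simpa using add_mem hx hy
  | smul_mem g f hf =>
    rw [smul_eq_mul, Subalgebra.coe_mul, coeff_mul]
    refine sum_mem fun p hp ↦ ?_
    have hp := Finset.HasAntidiagonal.mem_antidiagonal.mp hp
    rcases lt_or_ge (f : S[X]).natDegree p.2 with hdeg | hdeg
    · rw [coeff_eq_zero_of_natDegree_lt hdeg, mul_zero]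
      exact zero_mem _
    · have hNu : N ⟨f, hf⟩ + (f : S[X]).natDegree ≤ u :=
        (Finset.le_sup (f := fun f : s ↦ N f + (f.1 : S[X]).natDegree)
          (Finset.mem_attach s ⟨f, hf⟩)).trans hu
      refine forall_mem_pow_mul_mem (a := p.1 - N ⟨f, hf⟩) (b := N ⟨f, hf⟩) (fun x hx y hy ↦ ?_) _
        ?_
      · rw [mul_assoc]
        exact mul_mem_pow_sup hx (hN ⟨f, hf⟩ p.2 y hy) (by lia)
      · rw [Nat.sub_add_cancel (by lia)]
        exact g.2 p.1

theorem not_le_reesDegreeOne {P : Ideal (reesAlgebra J)}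
    (hP : P ∈ associatedPrimes (reesAlgebra J) (reesAlgebra J ⧸ reesTorsion J I)) :
    ¬ J ≤ reesDegreeOne P := by
  intro hle
  obtain ⟨f, hf, hPf⟩ := exists_notMem_of_mem_associatedPrimes hP
  obtain ⟨u₀, hu₀⟩ := exists_forall_coeff_mem_of_mem_reesTorsion J I
  refine hf ⟨u₀ + 1, fun u ↦ forall_mem_pow_mul_mem fun a ha b hb ↦ ?_⟩
  have hbf : reesMonomial J 1 ⟨b, hb⟩ * f ∈ reesTorsion J I :=
    hPf _ ((coe_mem_reesDegreeOne ⟨b, hb⟩).mp (hle (by simpa using hb)))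
  have hab := hu₀ _ (Ideal.mul_mem_left _ (reesMonomial J u₀ ⟨a, ha⟩) hbf) (u + 1 + u₀) (by lia)
  rw [coeff_reesMonomial_mul, coeff_reesMonomial_mul, ← mul_assoc] at hab
  rwa [show u₀ + 1 + u + 1 = u + 1 + u₀ + 1 by lia]

theorem exists_forall_mem_of_notMem_reesDegreeOne {x : S} (hx : x ∈ J)
    (hxP : ∀ P ∈ associatedPrimes (reesAlgebra J) (reesAlgebra J ⧸ reesTorsion J I),
      x ∉ reesDegreeOne P) :
    ∃ j₀, ∀ j, j₀ ≤ j → ∀ c ∈ J ^ j, x * c ∈ J ^ (j + 2) ⊔ I → c ∈ J ^ (j + 1) ⊔ I := by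
  obtain ⟨u₀, hu₀⟩ := exists_forall_coeff_mem_of_mem_reesTorsion J I
  let xt := reesMonomial J 1 ⟨x, by rwa [pow_one]⟩
  refine ⟨u₀, fun j hj c hc hxc ↦ ?_⟩
  have hmul : xt * reesMonomial J j ⟨c, hc⟩ ∈ reesTorsion J I := by
    refine ⟨0, fun u a _ ↦ Ideal.mul_mem_left _ _ ?_⟩
    rw [Subalgebra.coe_mul, coe_reesMonomial, coe_reesMonomial, monomial_mul_monomial,
      coeff_monomial]
    split_ifs with hu
    · rwa [← hu, show 0 + (1 + j) + 1 = j + 2 by lia]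
    · exact zero_mem _
  have htor : reesMonomial J j ⟨c, hc⟩ ∈ reesTorsion J I :=
    mem_of_mul_mem_of_forall_notMem_associatedPrimes
      (fun P hP h ↦ hxP P hP ((coe_mem_reesDegreeOne _).mpr h)) hmul
  simpa [coe_reesMonomial] using hu₀ _ htor j hj

end ReesAlgebra

section ArtinRees

variable {S : Type*} [CommRing S]

theorem mk_mem_smul_top_iff {I J : Ideal S} {c : S} :
    (Submodule.Quotient.mk c : S ⧸ I) ∈ J • (⊤ : Submodule S (S ⧸ I)) ↔ c ∈ J ⊔ I := by
  have h : J • (⊤ : Submodule S (S ⧸ I)) = Submodule.map (Submodule.mkQ I) J := by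
    rw [← Submodule.range_mkQ I, LinearMap.range_eq_map, ← Submodule.map_smul'', smul_eq_mul,
      Ideal.mul_top]
  rw [h, ← Submodule.mkQ_apply, ← Submodule.mem_comap, Submodule.comap_map_mkQ, sup_comm]

theorem exists_forall_mem_pow_smul_top_of_smul_mem [IsNoetherianRing S] (J : Ideal S) {M : Type*}
    [AddCommGroup M] [Module S M] [Module.Finite S M] {x : S} (hx : IsSMulRegular M x) :
    ∃ k, ∀ n, ∀ c : M, x • c ∈ J ^ (n + k) • (⊤ : Submodule S M) →
      c ∈ J ^ n • (⊤ : Submodule S M) := by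
  obtain ⟨k, hk⟩ := J.exists_pow_inf_eq_pow_smul (Submodule.map (LinearMap.lsmul S M x) ⊤)
  refine ⟨k, fun n c hc ↦ ?_⟩
  have hxc := (hk (n + k) (Nat.le_add_left k n)).le ⟨hc, c, Submodule.mem_top, rfl⟩
  rw [Nat.add_sub_cancel] at hxc
  have hmap := Submodule.smul_mono le_rfl inf_le_right hxc
  rw [← Submodule.map_smul''] at hmap
  exact hx.mem_set_image.mp hmap

theorem exists_forall_mem_of_mul_mem [IsNoetherianRing S] {I J : Ideal S} {x : S}
    (hreg : ∀ c, x * c ∈ I → c ∈ I)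
    (hx : ∃ j₀, ∀ j, j₀ ≤ j → ∀ c ∈ J ^ j, x * c ∈ J ^ (j + 2) ⊔ I → c ∈ J ^ (j + 1) ⊔ I) :
    ∃ j₀, ∀ j, j₀ ≤ j → ∀ c, x * c ∈ J ^ (j + 1) ⊔ I → c ∈ J ^ j ⊔ I := by
  obtain ⟨j₀, hj₀⟩ := hx
  obtain ⟨k, hk⟩ := exists_forall_mem_pow_smul_top_of_smul_mem J
    ((isSMulRegular_quotient_iff_mem_of_smul_mem I x).mpr hreg)
  refine ⟨j₀ + k, fun j hj c hc ↦ ?_⟩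
  have hstart : c ∈ J ^ j₀ ⊔ I := mk_mem_smul_top_iff.mp <| hk j₀ _ <| mk_mem_smul_top_iff.mpr <|
    sup_le_sup_right (Ideal.pow_le_pow_right (by lia)) I hc
  have hstep (i : ℕ) (hi : j₀ ≤ i) (hij : i ≤ j) : c ∈ J ^ i ⊔ I := by
    induction i, hi using Nat.le_induction with
    | base => exact hstart
    | succ i hi ih =>
      obtain ⟨a, ha, b, hb, rfl⟩ := Submodule.mem_sup.mp (ih (by lia))
      refine add_mem (hj₀ i hi a ha ?_) (Ideal.mem_sup_right hb)
      rw [← add_sub_cancel_right a b, mul_sub]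
      exact sub_mem (sup_le_sup_right (Ideal.pow_le_pow_right (by lia)) I hc)
        (Ideal.mem_sup_right (Ideal.mul_mem_left _ _ hb))
  exact hstep j (by lia) le_rfl

end ArtinRees

/-! ### Reduction modulo a superficial sequence -/

section Existence

variable {S : Type u} [CommRing S] [IsLocalRing S] {W : Type u} [AddCommGroup W] [Module S W]

theorem subsingleton_ext_quotSMulTop {x : S} (hx : IsSMulRegular W x) {i : ℕ}
    (h : Subsingleton (ExtModule S (ResidueField S) W i))
    (h' : Subsingleton (ExtModule S (ResidueField S) W (i + 1))) :
    Subsingleton (ExtModule S (ResidueField S) (QuotSMulTop x W) i) :=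
  subsingleton_ext_of_covariant₃
    (IsSMulRegular.smulShortComplex_shortExact (M := ModuleCat.of S W) hx) h h'

theorem subsingleton_ext_quotient_sup_span {I : Ideal S} {x : S} (hx : ∀ c, x * c ∈ I → c ∈ I)
    {i : ℕ} (h : Subsingleton (ExtModule S (ResidueField S) (S ⧸ I) i))
    (h' : Subsingleton (ExtModule S (ResidueField S) (S ⧸ I) (i + 1))) :
    Subsingleton (ExtModule S (ResidueField S) (S ⧸ I ⊔ Ideal.span {x}) i) :=
  subsingleton_ext_of_covariant₃
    (shortExact_mulQuotient fun c ↦ ⟨hx c, fun hc ↦ Ideal.mul_mem_left _ _ hc⟩) h h'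

variable [IsNoetherianRing S]

theorem not_maximalIdeal_le_of_mem_associatedPrimes
    (h : Subsingleton (ExtModule S (ResidueField S) W 0)) {P : Ideal S}
    (hP : P ∈ associatedPrimes S W) : ¬ maximalIdeal S ≤ P := by
  intro hle
  obtain ⟨hprime, f, hf⟩ := (isAssociatedPrime_iff_exists_injective_linearMap P W).mp hP
  obtain rfl := (maximalIdeal.isMaximal S).eq_of_le hprime.ne_top hle
  have : Subsingleton (ResidueField S →ₗ[S] W) := subsingleton_ext_zero_iff.mp h
  have hzero : f = 0 := Subsingleton.elim (α := ResidueField S →ₗ[S] W) f 0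
  exact one_ne_zero (α := ResidueField S) (hf (by rw [hzero]; rfl))

theorem not_maximalIdeal_le_sq_sup {I : Ideal S} (hI : I ≤ maximalIdeal S)
    (h : Subsingleton (ExtModule S (ResidueField S) (S ⧸ I) 0)) :
    ¬ maximalIdeal S ≤ maximalIdeal S ^ 2 ⊔ I := by
  intro hle
  obtain rfl := hI.antisymm (maximalIdeal_le_of_le_sq_sup hle)
  exact not_subsingleton (Module.End S (ResidueField S)) (subsingleton_ext_zero_iff.mp h)

variable [Infinite (ResidueField S)] [Module.Finite S W]

theorem exists_superficial_isSMulRegular {I : Ideal S} (hI : I ≤ maximalIdeal S)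
    (hSI : Subsingleton (ExtModule S (ResidueField S) (S ⧸ I) 0))
    (hW : Subsingleton (ExtModule S (ResidueField S) W 0)) :
    ∃ x ∈ maximalIdeal S, x ∉ maximalIdeal S ^ 2 ⊔ I ∧ (∀ c, x * c ∈ I → c ∈ I) ∧
      (∃ j₀, ∀ j, j₀ ≤ j → ∀ c, x * c ∈ maximalIdeal S ^ (j + 1) ⊔ I →
        c ∈ maximalIdeal S ^ j ⊔ I) ∧ IsSMulRegular W x := by
  let A := reesAlgebra (maximalIdeal S)
  let E : Set (Ideal A) := associatedPrimes A (A ⧸ reesTorsion (maximalIdeal S) I)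
  have hE : E.Finite := associatedPrimes.finite A _
  obtain ⟨x, hx, hxT⟩ := exists_mem_maximalIdeal_forall_notMem
    (T := insert (maximalIdeal S ^ 2 ⊔ I)
      (reesDegreeOne '' E ∪ associatedPrimes S (S ⧸ I) ∪ associatedPrimes S W))
    ((((hE.image _).union (associatedPrimes.finite S _)).union
      (associatedPrimes.finite S W)).insert _) (by
      rintro V (rfl | (⟨P, hP, rfl⟩ | hV) | hV)
      · exact not_maximalIdeal_le_sq_sup hI hSI
      · exact not_le_reesDegreeOne hP
      · exact not_maximalIdeal_le_of_mem_associatedPrimes hSI hV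
      · exact not_maximalIdeal_le_of_mem_associatedPrimes hW hV)
  have hxI (c : S) : x * c ∈ I → c ∈ I :=
    mem_of_mul_mem_of_forall_notMem_associatedPrimes fun V hV ↦ hxT V (.inr (.inl (.inr hV)))
  exact ⟨x, hx, hxT _ (.inl rfl), hxI, exists_forall_mem_of_mul_mem hxI
      (exists_forall_mem_of_notMem_reesDegreeOne hx
        fun P hP ↦ hxT _ (.inr (.inl (.inl ⟨P, hP, rfl⟩)))),
    isSMulRegular_of_forall_notMem_associatedPrimes fun V hV ↦ hxT V (.inr (.inr hV))⟩

variable (W) in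
theorem exists_isSuperficialSequence (d : ℕ) {I : Ideal S} (hI : I ≤ maximalIdeal S)
    (hSI : ∀ i < d, Subsingleton (ExtModule S (ResidueField S) (S ⧸ I) i))
    (hW : ∀ i < d, Subsingleton (ExtModule S (ResidueField S) W i)) :
    ∃ rs : List S, rs.length = d ∧ IsSuperficialSequence I rs ∧
      RingTheory.Sequence.IsWeaklyRegular W rs := by
  induction d generalizing I W with
  | zero => exact ⟨[], rfl, trivial, .nil S W⟩
  | succ d ih =>
    obtain ⟨x, hx, hxsq, hxI, hsup, hxW⟩ :=
      exists_superficial_isSMulRegular hI (hSI 0 d.succ_pos) (hW 0 d.succ_pos)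
    obtain ⟨rs, rfl, hrs, hrsW⟩ := ih (QuotSMulTop x W)
      (sup_le hI ((Ideal.span_singleton_le_iff_mem _).mpr hx))
      (fun i hi ↦ subsingleton_ext_quotient_sup_span hxI (hSI i (by lia)) (hSI (i + 1) (by lia)))
      (fun i hi ↦ subsingleton_ext_quotSMulTop hxW (hW i (by lia)) (hW (i + 1) (by lia)))
    exact ⟨x :: rs, rfl, ⟨hx, hxsq, hxI, hsup, hrs⟩, .cons hxW hrsW⟩

end Existence

section InfiniteResidueField

open Polynomial

theorem exists_flat_infinite_residueField (R : Type u) [CommRing R] [IsLocalRing R]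
    [IsNoetherianRing R] :
    ∃ (S : Type u) (_ : CommRing S) (_ : IsLocalRing S) (_ : IsNoetherianRing S) (_ : Algebra R S),
      Module.Flat R S ∧ Infinite (ResidueField S) ∧
        (maximalIdeal R).map (algebraMap R S) = maximalIdeal S := by
  let 𝔭 : Ideal R[X] := (maximalIdeal R).map C
  have hprime : 𝔭.IsPrime := Ideal.isPrime_map_C_of_isPrime
  let S := Localization.AtPrime 𝔭
  have hflat : Module.Flat R[X] S := IsLocalization.flat S 𝔭.primeCompl
  refine ⟨S, inferInstance, inferInstance, IsLocalization.isNoetherianRing 𝔭.primeCompl S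
    inferInstance, inferInstance, Module.Flat.trans R R[X] S, ?_, ?_⟩
  · refine Infinite.of_injective (fun i : ℕ ↦ residue S (algebraMap R[X] S (X ^ i)))
      fun i j hij ↦ ?_
    by_contra hne
    have hmem : algebraMap R[X] S (X ^ i - X ^ j) ∈ maximalIdeal S := by
      rw [← residue_eq_zero_iff, map_sub, map_sub]
      exact sub_eq_zero.mpr hij
    have hcoeff := Ideal.mem_map_C_iff.mp
      ((IsLocalization.AtPrime.to_map_mem_maximal_iff S 𝔭 _).mp hmem) i
    rw [coeff_sub, coeff_X_pow_self, coeff_X_pow, if_neg hne, sub_zero] at hcoeff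
    exact (Ideal.ne_top_iff_one _).mp (maximalIdeal.isMaximal R).ne_top hcoeff
  · rw [IsScalarTower.algebraMap_eq R R[X] S, ← Ideal.map_map]
    exact Localization.AtPrime.map_eq_maximalIdeal

end InfiniteResidueField

section Reduction

open scoped TensorProduct

theorem IsSuperficialSequence.mem_sup_ofList_take {S : Type*} [CommRing S] [IsLocalRing S]
    {I : Ideal S} {rs : List S} (h : IsSuperficialSequence I rs) {i : ℕ} (hi : i < rs.length)
    {c : S} (hc : rs[i] * c ∈ I ⊔ Ideal.ofList (rs.take i)) :
    c ∈ I ⊔ Ideal.ofList (rs.take i) := by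
  induction rs generalizing I i with
  | nil => simp at hi
  | cons x rs ih =>
    obtain ⟨-, -, hx, -, hrs⟩ := h
    cases i with
    | zero => simpa [Ideal.ofList_nil] using hx c (by simpa [Ideal.ofList_nil] using hc)
    | succ i =>
      rw [List.take_succ_cons, Ideal.ofList_cons, ← sup_assoc] at hc ⊢
      exact ih hrs (Nat.lt_of_succ_lt_succ hi) hc

variable {S : Type u} [CommRing S] [IsLocalRing S] {M : Type u} [AddCommGroup M]

theorem IsSuperficialSequence.isWeaklyRegular {rs : List S} (h : IsSuperficialSequence ⊥ rs) :
    RingTheory.Sequence.IsWeaklyRegular S rs := by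
  refine ⟨fun i hi ↦ (isSMulRegular_quotient_iff_mem_of_smul_mem _ _).mpr fun c hc ↦ ?_⟩
  rw [smul_eq_mul, Ideal.mul_top] at hc ⊢
  simpa using h.mem_sup_ofList_take hi (by simpa using hc)

theorem isRegular_of_isWeaklyRegular [Module S M] [Module.Finite S M] [Nontrivial M] {rs : List S}
    (hrs : ∀ x ∈ rs, x ∈ maximalIdeal S) (h : RingTheory.Sequence.IsWeaklyRegular M rs) :
    RingTheory.Sequence.IsRegular M rs :=
  ⟨h, fun htop ↦ maximalIdeal_smul_top_lt.not_ge
    (htop.le.trans (Submodule.smul_mono (Ideal.span_le.mpr hrs) le_rfl))⟩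

variable {R : Type u} [CommRing R] [IsLocalRing R] [Algebra R S] [Module.Flat R S] [Module R M]

theorem faithfullyFlat_of_map_maximalIdeal
    (hm : (maximalIdeal R).map (algebraMap R S) = maximalIdeal S) : Module.FaithfullyFlat R S :=
  have : IsLocalHom (algebraMap R S) :=
    ((IsLocalRing.local_hom_TFAE (algebraMap R S)).out 2 0).mp hm.le
  .of_flat_of_isLocalHom

theorem depth_le_depth_tensorProduct
    (hm : (maximalIdeal R).map (algebraMap R S) = maximalIdeal S) :
    depth R M ≤ depth S (S ⊗[R] M) := by
  have := faithfullyFlat_of_map_maximalIdeal hm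
  refine iSup_le fun ⟨rs, hrs, hreg⟩ ↦ ?_
  rw [← List.length_map (algebraMap R S)]
  refine length_le_depth ?_
    (hreg.of_faithfullyFlat_of_isBaseChange (TensorProduct.isBaseChange R M S))
  rw [List.forall_mem_map]
  exact fun x hx ↦ hm ▸ Ideal.mem_map_of_mem _ (hrs x hx)

theorem exists_pow_maximalIdeal_le_of_isRegular [IsNoetherianRing S] {rs : List S}
    (h : RingTheory.Sequence.IsRegular S rs) (hd : ringKrullDim S = rs.length) :
    ∃ C, maximalIdeal S ^ C ≤ Ideal.ofList rs := by
  have hdim := ringKrullDim_add_length_eq_ringKrullDim_of_isRegular rs h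
  have : Ring.KrullDimLE 0 (S ⧸ Ideal.ofList rs) := by
    rw [hd] at hdim
    exact Ring.krullDimLE_iff.mpr
      (ENat.WithBot.add_natCast_cancel.mp (hdim.trans (zero_add _).symm)).le
  have := IsNoetherianRing.isArtinianRing_of_krullDimLE_zero (R := S ⧸ Ideal.ofList rs)
  exact exists_maximalIdeal_pow_le_of_isArtinianRing_quotient _

theorem exists_flat_isRegular [IsNoetherianRing R] {d : ℕ} (hd : ringKrullDim R = d)
    (hR : depth R R = d) (hmin : HasMinimalMultiplicity R) [Module.Finite R M] [Nontrivial M]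
    (hM : depth R M = d) (hsyz : IsImageOfResidueFieldSyzygies R M) :
    ∃ (S : Type u) (_ : CommRing S) (_ : IsLocalRing S) (_ : Algebra R S) (rs : List S),
      Module.Flat R S ∧ (maximalIdeal R).map (algebraMap R S) = maximalIdeal S ∧ rs.length = d ∧
        RingTheory.Sequence.IsRegular (S ⊗[R] M) rs ∧
        maximalIdeal S • (⊤ : Submodule S (S ⊗[R] M)) ≤ Ideal.ofList rs • ⊤ := by
  obtain ⟨S, _, _, _, _, _, _, hm⟩ := exists_flat_infinite_residueField R
  have := faithfullyFlat_of_map_maximalIdeal hm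
  have hS (i : ℕ) (hi : i < d) :
      Subsingleton (ExtModule S (ResidueField S) (S ⧸ (⊥ : Ideal S)) i) :=
    (subsingleton_ext_congr_right ((Submodule.quotEquivOfEqBot (⊥ : Ideal S) rfl).trans
      (TensorProduct.AlgebraTensorModule.rid R S S).symm).toModuleIso).mpr <|
      subsingleton_ext_of_lt_depth <|
        (Nat.cast_lt.mpr hi).trans_le (hR.ge.trans (depth_le_depth_tensorProduct hm))
  have hSM (i : ℕ) (hi : i < d) : Subsingleton (ExtModule S (ResidueField S) (S ⊗[R] M) i) :=
    subsingleton_ext_of_lt_depth <|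
      (Nat.cast_lt.mpr hi).trans_le (hM.ge.trans (depth_le_depth_tensorProduct hm))
  obtain ⟨rs, rfl, hrs, hrsM⟩ := exists_isSuperficialSequence (S ⊗[R] M) d bot_le hS hSM
  have hdS : ringKrullDim S = rs.length := (ringKrullDim_eq_of_flat hm).trans hd
  obtain ⟨C, hC⟩ := exists_pow_maximalIdeal_le_of_isRegular
    (isRegular_of_isWeaklyRegular hrs.forall_mem hrs.isWeaklyRegular) hdS
  have hsq := hrs.maximalIdeal_sq_le (hmin.of_flat hm) hdS hC
  exact ⟨S, inferInstance, inferInstance, inferInstance, rs, inferInstance, hm, rfl,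
    isRegular_of_isWeaklyRegular hrs.forall_mem hrsM, hsyz.maximalIdeal_smul_top_le hm hrs hsq⟩

end Reduction

section Vanishing

variable {R : Type u} [CommRing R] [IsLocalRing R] [IsNoetherianRing R] {d : ℕ}
  (hd : ringKrullDim R = d) (hR : depth R R = d) (hmin : HasMinimalMultiplicity R)
  {L : Type u} [AddCommGroup L] [Module R L] [Module.Finite R L] [Nontrivial L]
  (hL : depth R L = d) (hsyz : IsImageOfResidueFieldSyzygies R L)
  {W : Type u} [AddCommGroup W] [Module R W] (P : MinimalFreeResolution R W) {n : ℕ}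

include hd hR hmin hL hsyz

theorem MinimalFreeResolution.rank_eq_zero_of_subsingleton_ext
    (h : ∀ i, n + 1 ≤ i → i ≤ n + 1 + d → Subsingleton (ExtModule R W L i)) :
    P.rank (n + 1) = 0 := by
  obtain ⟨S, _, _, _, rs, _, hm, rfl, hreg, hle⟩ := exists_flat_isRegular hd hR hmin hL hsyz
  have hA (i : ℕ) (j k) : (P.matrix i).transpose.map (algebraMap R S) j k ∈ maximalIdeal S :=
    hm ▸ Ideal.mem_map_of_mem _ (P.matrix_mem i k j)
  have := isEmpty_of_exact_cochain (ι := fun i ↦ Fin (P.rank i)) _ hA rs n _ hreg hle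
    fun i _ _ ↦ exact_matrixMap_baseChange S
      (P.exact_matrixMap_transpose (h (i + 1) (by lia) (by lia)))
  exact by_contra fun hr ↦ this.elim ⟨0, Nat.pos_of_ne_zero hr⟩

theorem MinimalFreeResolution.rank_eq_zero_of_subsingleton_tor
    (h : ∀ i, n + 1 ≤ i → i ≤ n + 1 + d → Subsingleton (TorModule R W L i)) :
    P.rank (n + d + 1) = 0 := by
  obtain ⟨S, _, _, _, rs, _, hm, rfl, hreg, hle⟩ := exists_flat_isRegular hd hR hmin hL hsyz
  have hA (i : ℕ) (j k) : (P.matrix i).map (algebraMap R S) j k ∈ maximalIdeal S :=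
    hm ▸ Ideal.mem_map_of_mem _ (P.matrix_mem i j k)
  have := isEmpty_of_exact_chain (ι := fun i ↦ Fin (P.rank i)) _ hA rs n _ hreg hle
    fun i _ _ ↦ exact_matrixMap_baseChange S (P.exact_matrixMap (h (i + 1) (by lia) (by lia)))
  exact by_contra fun hr ↦ this.elim ⟨0, Nat.pos_of_ne_zero hr⟩

end Vanishing

theorem IsMCM.depth_eq {R : Type u} [CommRing R] [IsLocalRing R] {d : ℕ}
    (hd : ringKrullDim R = d) {M : Type u} [AddCommGroup M] [Module R M] (hM : IsMCM R M) :
    depth R M = d := by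
  have := hM.isCohenMacaulayModule.depth_eq
  rw [hM.dim_eq, hd] at this
  exact_mod_cast this

end CMLocal

theorem theorem5p5 (R : Type u) [CommRing R] [IsLocalRing R] [IsNoetherianRing R]
    (d : ℕ) (hd : ringKrullDim R = d)
    (hCM : CMLocal.IsCohenMacaulayRing R)
    (hmin : CMLocal.HasMinimalMultiplicity R)
    (ω : Type u) [AddCommGroup ω] [Module R ω] (hω : CMLocal.IsCanonicalModule R ω)
    (L : Type u) [AddCommGroup L] [Module R L] [Nontrivial L] (hL : CMLocal.IsMCM R L)
    (hsyz : CMLocal.IsImageOfResidueFieldSyzygies R L) :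
    List.TFAE
      [∃ n : ℕ, 1 ≤ n ∧ ∀ i : ℕ, n ≤ i → i ≤ n + d → Subsingleton (CMLocal.ExtModule R ω L i),
        ∀ i : ℕ, 1 ≤ i → Subsingleton (CMLocal.ExtModule R ω L i),
        CMLocal.IsGorenstein R,
        ∃ n : ℕ, 1 ≤ n ∧ ∀ i : ℕ, n ≤ i → i ≤ n + d → Subsingleton (CMLocal.TorModule R ω L i),
        ∀ i : ℕ, 1 ≤ i → Subsingleton (CMLocal.TorModule R ω L i)] := by
  have hR := CMLocal.IsMCM.depth_eq hd ⟨hCM, Module.supportDim_self_eq_ringKrullDim R⟩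
  have hLd := hL.depth_eq hd
  have := hω.finite
  have := hL.isCohenMacaulayModule.finite
  obtain ⟨P⟩ := CMLocal.nonempty_minimalFreeResolution (R := R) ω
  have isGorenstein_of_rank_eq_zero {n : ℕ} (h : P.rank (n + 1) = 0) : CMLocal.IsGorenstein R :=
    have := P.free_of_rank_eq_zero hR (fun i hi ↦ hω.subsingleton_ext hd hi.ne) h
    hω.isGorenstein_of_free hd
  tfae_have 2 → 1 := fun h ↦ ⟨1, le_rfl, fun i hi _ ↦ h i hi⟩
  tfae_have 5 → 4 := fun h ↦ ⟨1, le_rfl, fun i hi _ ↦ h i hi⟩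
  tfae_have 1 → 3
  | ⟨_ + 1, _, h⟩ =>
    isGorenstein_of_rank_eq_zero (P.rank_eq_zero_of_subsingleton_ext hd hR hmin hLd hsyz h)
  tfae_have 4 → 3
  | ⟨_ + 1, _, h⟩ =>
    isGorenstein_of_rank_eq_zero (P.rank_eq_zero_of_subsingleton_tor hd hR hmin hLd hsyz h)
  tfae_have 3 → 2
  | hG, i + 1, _ =>
    have := hω.free_of_isGorenstein hd hR hG
    CMLocal.subsingleton_ext_of_projective i
  tfae_have 3 → 5
  | hG, i + 1, _ =>
    have := hω.free_of_isGorenstein hd hR hG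
    CMLocal.subsingleton_tor_of_flat i
  tfae_finish
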